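/- Let $n\ge 1$. A neural net with $n$ inputs is an activation function $h:\mathbb{R}\to\mathbb{R}$ together with a finite acyclic directed graph $G$ with real edge weights, whose vertices without incoming edges are exactly a constant vertex $v_0$ and $n$ input vertices $v_1,\dots,v_n$ (all distinct), and which has a vertex $v_{out}$ reachable from every other vertex. For $x\in\mathbb{R}^n$, $\mathrm{eval}_{(h,G)}(x)$ is the value $y_{v_{out}}$, where $y_{v_0}=1$, $y_{v_i}=x_i$, and $y_v=h\big(\sum_{(u,v)\in E(G)}w_{u,v}\,y_u\big)$ for every other vertex $v$. For edge weights $W$, let $G_W$ be $G$ with its edge weights changed to $W$. Identify the set $\mathbb{B}$ of two bits with two distinct real numbers (for example $\{0,1\}$ or $\{1,-1\}$), and for $s\subseteq[n]$ let $p_s:\mathbb{B}^n\to\mathbb{B}$ be the parity function of the bits $x_i$, $i\in s$. Let $(h,G)$ be a neural net with $n$ inputs and $m$ edges and let $L:\mathbb{R}\to\mathbb{R}$ be a loss function, $h$ and $L$ being three times continuously differentiable. Let $B>0$, $0<\gamma\le \pi n/(80m^2B)$, let $T$ be a positive integer, and set $$\sigma=\frac{1}{2\pi}\Big(\frac{40m\gamma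 B}{n}\Big)^2,\qquad \sigma'=\big(2mB\gamma-m^2B^2\gamma^2\big)\sigma,\qquad \tau=\frac{160m^2\gamma B}{\pi n}.$$ Draw $S\subseteq[n]$ uniformly, draw $X_0,\dots,X_{T-1}$ and $X$ uniformly from $\mathbb{B}^n$, draw $\xi$ from $\mathcal{N}(0,\sigma I)$ and $\delta^{(0)},\dots,\delta^{(T-1)}$ from $\mathcal{N}(0,\sigma' I)$ on $\mathbb{R}^{E(G)}$ ($\sigma$ and $\sigma'$ are variances), all independently. Let $W_0=w(G)+\xi$, where $w(G)$ are the given edge weights, and for $0\le i<T$ let $$W_{i+1}=W_i-\gamma\nabla\ell_i(W_i)+\delta^{(i)},\qquad \ell_i(W)=L\big(\mathrm{eval}_{(h,G_W)}(X_i)-p_S(X_i)\big)$$ (noisy SGD on the random parity $p_S$). Let $p$ be the probability that there are $0\le i<T$ and edge weights $W'$, differing from $W_i$ by at most $\tau$ in each coordinate, such that some first, second or third partial derivative (mixed ones included) of $\ell_i$ at $W'$ has absolute value greater than $B$. Then for every measurable rule $D:\mathbb{R}\to\mathbb{R}$ that turns the net's output into a prediction (the identity, or thresholding), the trained net predicts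 the parity of $X$ with probability $$\mathbb{P}\big[D(\mathrm{eval}_{(h,G_{W_T})}(X))=p_S(X)\big]\le \frac12+2p+T\left(\frac{360\,m^4B^2\gamma^2}{\pi n}+7\Big(\frac e4\Big)^{n/4}\right).$$ -/

import Mathlib

open MeasureTheory ProbabilityTheory

namespace ParityNet

/-! ### Neural nets -/

/-- A neural net with input size `n` on the finite vertex set `V`: an activation function together
with a weighted acyclic directed graph whose vertices without incoming edges are exactly the
(distinct) constant vertex and the `n` input vertices, and in which every vertex other than the
output vertex has a path to the output vertex. -/
structure NeuralNet (n : ℕ) (V : Type*) where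
  /-- the activation function -/
  act : ℝ → ℝ
  /-- the edge set; `(u, v)` is an edge from `u` to `v` -/
  edges : Finset (V × V)
  /-- the edge weights -/
  weight : edges → ℝ
  acyclic : ∀ v, ¬ Relation.TransGen (fun a b => (a, b) ∈ edges) v v
  /-- the constant vertex -/
  const : V
  /-- the input vertices -/
  input : Fin n → V
  /-- the output vertex -/
  out : V
  input_injective : Function.Injective input
  input_ne_const : ∀ i, input i ≠ const
  source_iff : ∀ v, (∀ u, (u, v) ∉ edges) ↔ (v = const ∨ ∃ i, v = input i)
  path_to_out : ∀ v, v ≠ out → Relation.TransGen (fun a b => (a, b) ∈ edges) v out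

namespace NeuralNet

theorem wellFounded_edge {n : ℕ} {V : Type*} [Fintype V] (N : NeuralNet n V) : WellFounded (fun a b => (a, b) ∈ N.edges) := by
  have hirr : Std.Irrefl (Relation.TransGen (fun a b => (a, b) ∈ N.edges)) := ⟨N.acyclic⟩
  have h : WellFounded (Relation.TransGen (fun a b => (a, b) ∈ N.edges)) :=
    Finite.wellFounded_of_trans_of_irrefl _
  exact Subrelation.wf (fun hab => Relation.TransGen.single hab) h

variable {n : ℕ} {V : Type*} [Fintype V] [DecidableEq V]

open Classical in
/-- The value `y_v` carried by the vertex `v` when the edge weights are `w` and the input is `x`: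
`1` at the constant vertex, `x i` at the `i`-th input vertex, and
`act (∑ w_{u,v} y_u)`, the sum being over all edges `(u, v)`, at every other vertex. -/
noncomputable def value (N : NeuralNet n V) (w : N.edges → ℝ) (x : Fin n → ℝ) : V → ℝ :=
  N.wellFounded_edge.fix fun v y =>
    if v = N.const then 1
    else if h : ∃ i, v = N.input i then x h.choose
    else N.act (∑ u : {u : V // (u, v) ∈ N.edges}, w ⟨(u.1, v), u.2⟩ * y u.1 u.2)

/-- The evaluation of the net, with its edge weights changed to `w`, at the input `x`. -/
noncomputable def eval (N : NeuralNet n V) (w : N.edges → ℝ) (x : Fin n → ℝ) : ℝ :=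
  N.value w x N.out

end NeuralNet

/-! ### Parities -/

/-- The parity function `p_s` on bit strings. -/
def parity {n : ℕ} (s : Finset (Fin n)) (x : Fin n → Bool) : Bool :=
  decide (Odd (s.filter fun i => x i = true).card)

/-! ### Partial derivatives -/

/-- The partial derivative of `g` with respect to the coordinate `e`. -/
noncomputable def partialDeriv {ι : Type*} [DecidableEq ι] (e : ι) (g : (ι → ℝ) → ℝ) :
    (ι → ℝ) → ℝ :=
  fun w => lineDeriv ℝ g w (Pi.single e 1)

/-- Some partial derivative of `g` of order one, two or three (mixed ones included) has absolute
value greater than `B` at `w`. -/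
def HasLargeDeriv {ι : Type*} [DecidableEq ι] (B : ℝ) (g : (ι → ℝ) → ℝ) (w : ι → ℝ) : Prop :=
  (∃ e, B < |partialDeriv e g w|) ∨
  (∃ e₁ e₂, B < |partialDeriv e₁ (partialDeriv e₂ g) w|) ∨
  (∃ e₁ e₂ e₃, B < |partialDeriv e₁ (partialDeriv e₂ (partialDeriv e₃ g)) w|)

/-! ### Noisy stochastic gradient descent -/

namespace NeuralNet

variable {n : ℕ} {V : Type*} [Fintype V] [DecidableEq V]

/-- The loss `L (eval x - y)` on the sample `(x, y)`, as a function of the edge weights. Bits are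
turned into real numbers by `enc`. -/
noncomputable def loss (N : NeuralNet n V) (L : ℝ → ℝ) (enc : Bool → ℝ) (x : Fin n → Bool)
    (y : Bool) (w : N.edges → ℝ) : ℝ :=
  L (N.eval w (fun i => enc (x i)) - enc y)

/-- The edge weights after `i` steps of noisy stochastic gradient descent with learning rate `γ`,
started at the weights of `N` perturbed by `ξ`. Step `j` uses the sample `(X j, Y j)` and the
noise `δ j`, and changes each weight `w_e` to `w_e - γ ∂_e loss + δ_e`. -/
noncomputable def noisySGD (N : NeuralNet n V) (L : ℝ → ℝ) (enc : Bool → ℝ) (γ : ℝ) {T : ℕ}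
    (ξ : N.edges → ℝ) (X : Fin T → Fin n → Bool) (Y : Fin T → Bool)
    (δ : Fin T → N.edges → ℝ) : (i : ℕ) → i ≤ T → N.edges → ℝ
  | 0, _ => fun e => N.weight e + ξ e
  | i + 1, h => fun e =>
      noisySGD N L enc γ ξ X Y δ i (Nat.le_of_succ_le h) e
        - γ * partialDeriv e (N.loss L enc (X ⟨i, h⟩) (Y ⟨i, h⟩))
            (noisySGD N L enc γ ξ X Y δ i (Nat.le_of_succ_le h))
        + δ ⟨i, h⟩ e

end NeuralNet

/-! ### The random experiment -/

/-- An outcome `(S, x, ξ, X, δ)` of the experiment: the hidden set `S`, the test input `x`, the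
perturbation `ξ` of the initial weights (indexed by `ι`), and, for each of the `T` steps, the
training input `X i` and the noise `δ i`. -/
abbrev Outcome (n T : ℕ) (ι : Type*) : Type _ :=
  Finset (Fin n) × (Fin n → Bool) × (ι → ℝ) × (Fin T → Fin n → Bool) × (Fin T → ι → ℝ)

/-- The joint law of `(S, x, ξ, X, δ)`: all parts are independent; `S`, the test input and the
training inputs are uniform, the coordinates of `ξ` are centred Gaussians of variance `σ`, and the
coordinates of the `δ i` are centred Gaussians of variance `σ'`. -/
noncomputable def experiment (n T : ℕ) (ι : Type*) [Fintype ι] (σ σ' : NNReal) :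
    Measure (Outcome n T ι) :=
  (uniformOn Set.univ).prod <|
  (uniformOn Set.univ).prod <|
  (Measure.pi fun _ : ι => gaussianReal 0 σ).prod <|
  (Measure.pi fun _ : Fin T => uniformOn Set.univ).prod <|
  Measure.pi fun _ : Fin T => Measure.pi fun _ : ι => gaussianReal 0 σ'

namespace NeuralNet

variable {n : ℕ} {V : Type*} [Fintype V] [DecidableEq V]

/-- The edge weights after `i` steps when the net is trained on the hidden parity, that is, on the
samples `(X j, p_S (X j))`. -/
noncomputable def trained (N : NeuralNet n V) (L : ℝ → ℝ) (enc : Bool → ℝ) (γ : ℝ) {T : ℕ}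
    (ω : Outcome n T N.edges) (i : ℕ) (hi : i ≤ T) : N.edges → ℝ :=
  match ω with
  | (S, _, ξ, X, δ) => N.noisySGD L enc γ ξ X (fun j => parity S (X j)) δ i hi

/-- At some step `i < T` there are weights `w`, each within `τ` of the current weights, at which
some partial derivative of order one, two or three of the loss on the current sample exceeds `B`
in absolute value. -/
def largeDerivEvent (N : NeuralNet n V) (L : ℝ → ℝ) (enc : Bool → ℝ) (γ B τ : ℝ) (T : ℕ) :
    Set (Outcome n T N.edges) :=
  {ω | ∃ (i : Fin T) (w : N.edges → ℝ), (∀ e, |w e - N.trained L enc γ ω i i.isLt.le e| ≤ τ) ∧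
    match ω with
    | (S, _, _, X, _) => HasLargeDeriv B (N.loss L enc (X i) (parity S (X i))) w}

/-- After `T` steps of training, the net, whose real output is turned into a prediction by `D`,
computes the hidden parity of the test input correctly. -/
def correctEvent (N : NeuralNet n V) (L : ℝ → ℝ) (enc : Bool → ℝ) (γ : ℝ) (D : ℝ → ℝ) (T : ℕ) :
    Set (Outcome n T N.edges) :=
  {ω | match ω with
    | (S, x, _, _, _) =>
      D (N.eval (N.trained L enc γ ω T le_rfl) (fun j => enc (x j))) = enc (parity S x)}

end NeuralNet

end ParityNet

/-! Training is compared with a killed process, which stops with reward 0 once some point within `τ`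
of the current weights has a large derivative on the current sample; this costs at most the
probability `p`. For the killed process one averages over the hidden set S and proves, by induction
on the number of remaining steps, a bound on the expected reward valid for every starting law N(μ,
σI), uniformly in μ.

One step rests on two estimates. The first concerns the labels. For a fixed sample (x, y) the
gradient step sends the Gaussian, cut down to a ball, to a measure of density at most C₁ = e^{n/4}
relative to one Gaussian common to all samples, of slightly larger variance
(`ControlledField.map_step_le`). Replacing parity labels by uniformly random ones then changes the
reward, pointwise, by character coefficients of a bounded function on the cube. By Parseval and
Cauchy–Schwarz these cost at most C₁/(2√2ⁿ) on average over S (`sum_lintegral_parity_le`), which is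
exponentially small.

The second concerns the shape of the law. Once the label is random, the sample no longer depends on
S. The step is nearly its linearization at the centre: its law is dominated by 1 + R times the
linearized law (`ControlledField.lintegral_step_le`). The variance σ' is what the strongest possible
linear contraction loses, so the linearized law convolved with the noise is again a mixture of
Gaussians of covariance σI (`exists_gram_complement`), and the induction hypothesis applies to each
component. A step thus costs R, the Gaussian mass outside the ball, and C₁/(2√2ⁿ).

With no step left the weights are independent of S, and a nonzero test input has either parity for
exactly half of the sets. The zero input has probability 2⁻ⁿ. -/

namespace ParityNet

/-! ### Characters of the hypercube -/

section Characters

variable {n : ℕ}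

/-- The character `(-1) ^ p_s(x)` of the hypercube. -/
def character (s : Finset (Fin n)) (x : Fin n → Bool) : ℝ :=
  ∏ i ∈ s, if x i = true then -1 else 1

theorem character_eq_parity (s : Finset (Fin n)) (x : Fin n → Bool) :
    character s x = if parity s x = true then -1 else 1 := by
  rw [character, Finset.prod_ite, Finset.prod_const, Finset.prod_const_one, mul_one, parity]
  by_cases h : Odd (s.filter fun i => x i = true).card
  · simp [h, h.neg_one_pow]
  · simp [h, (Nat.not_odd_iff_even.mp h).neg_one_pow]

theorem sum_prod_eq (f : Fin n → ℝ) :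
    ∑ s : Finset (Fin n), ∏ i ∈ s, f i = ∏ i, (1 + f i) := by
  rw [Finset.prod_one_add, Finset.powerset_univ]

theorem sum_character {x : Fin n → Bool} (hx : ∃ i, x i = true) :
    ∑ s, character s x = 0 := by
  obtain ⟨i, hi⟩ := hx
  unfold character
  rw [sum_prod_eq]
  exact Finset.prod_eq_zero (Finset.mem_univ i) (by simp [hi])

/-- Orthogonality: the sum over sets factors over the coordinates, and a coordinate where x and y
differ contributes 1 - 1 = 0. -/
theorem sum_character_mul_character (x y : Fin n → Bool) :
    ∑ s, character s x * character s y = if x = y then 2 ^ n else 0 := by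
  unfold character
  simp_rw [← Finset.prod_mul_distrib]
  rw [sum_prod_eq]
  split_ifs with h
  · subst h
    have : ∀ i, (1 + (if x i = true then (-1 : ℝ) else 1) * (if x i = true then -1 else 1)) = 2 := by
      intro i; split_ifs <;> norm_num
    rw [Finset.prod_congr rfl fun i _ => this i]
    simp
  · obtain ⟨i, hi⟩ := Function.ne_iff.mp h
    refine Finset.prod_eq_zero (Finset.mem_univ i) ?_
    cases hx : x i <;> cases hy : y i <;> simp_all

/-- Parseval's identity, from expanding the squares and using orthogonality. -/
theorem sum_sq_character_transform (d : (Fin n → Bool) → ℝ) :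
    ∑ s, (∑ x, character s x * d x) ^ 2 = 2 ^ n * ∑ x, d x ^ 2 := by
  simp_rw [sq, Finset.sum_mul_sum]
  rw [Finset.sum_comm]
  simp_rw [Finset.sum_comm (s := (Finset.univ : Finset (Finset (Fin n))))]
  have : ∀ x y : Fin n → Bool, ∑ s, character s x * d x * (character s y * d y)
      = (if x = y then 2 ^ n else 0) * (d x * d y) := by
    intro x y
    rw [← sum_character_mul_character, Finset.sum_mul]
    exact Finset.sum_congr rfl fun s _ => by ring
  simp_rw [this]
  simp [Finset.mul_sum]

/-- Cauchy–Schwarz over the sets, then Parseval. The trivial bound is 4ⁿ C; the saving of √2ⁿ is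
what makes a random parity hard to detect. -/
theorem sum_abs_character_transform_le (d : (Fin n → Bool) → ℝ) {C : ℝ} (hC : 0 ≤ C)
    (hd : ∀ x, |d x| ≤ C) :
    ∑ s, |∑ x, character s x * d x| ≤ 2 ^ n * √(2 ^ n) * C := by
  have hcs : (∑ s : Finset (Fin n), |∑ x, character s x * d x|) ^ 2
      ≤ 2 ^ n * ∑ s, (∑ x, character s x * d x) ^ 2 := by
    have := sq_sum_le_card_mul_sum_sq (s := (Finset.univ : Finset (Finset (Fin n))))
      (f := fun s => |∑ x, character s x * d x|)
    simpa using this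
  have hsum : ∑ x, d x ^ 2 ≤ 2 ^ n * C ^ 2 := by
    have : ∑ x : Fin n → Bool, d x ^ 2 ≤ ∑ _x : Fin n → Bool, C ^ 2 :=
      Finset.sum_le_sum fun x _ => sq_le_sq' (by linarith [neg_abs_le (d x), hd x])
        (by linarith [le_abs_self (d x), hd x])
    simpa using this
  refine abs_le_of_sq_le_sq' ?_ (by positivity) |>.2
  rw [sum_sq_character_transform] at hcs
  calc _ ≤ _ := hcs
    _ ≤ 2 ^ n * (2 ^ n * (2 ^ n * C ^ 2)) := by gcongr
    _ = (2 ^ n * √(2 ^ n) * C) ^ 2 := by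
      rw [mul_pow, mul_pow, Real.sq_sqrt (by positivity)]; ring

/-- With d half the difference of the values at the two labels, the value at the true label is the
average over labels plus `character s x * d x`. Since 0 ≤ a ≤ C, d is at most C / 2, and the
character sums are controlled in absolute value, so the weights u s ∈ [0, 1] may depend on s
arbitrarily. -/
theorem sum_parity_le (a : (Fin n → Bool) → Bool → ℝ) (u : Finset (Fin n) → ℝ) {C : ℝ}
    (ha : ∀ x y, 0 ≤ a x y) (haC : ∀ x y, a x y ≤ C) (hu : ∀ s, 0 ≤ u s) (hu' : ∀ s, u s ≤ 1) :
    ∑ s, ∑ x, a x (parity s x) * u s ≤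
      ∑ s, ∑ x, ∑ y, (1 / 2) * (a x y * u s) + 2 ^ n * √(2 ^ n) * (C / 2) := by
  set d : (Fin n → Bool) → ℝ := fun x => (a x false - a x true) / 2
  have hC : 0 ≤ C := (ha (fun _ => true) true).trans (haC _ _)
  have hd : ∀ x, |d x| ≤ C / 2 := fun x => by
    rw [abs_le]
    constructor <;> simp only [d] <;>
      linarith [ha x true, ha x false, haC x true, haC x false]
  have key := sum_abs_character_transform_le d (C := C / 2) (by positivity) hd
  have hsplit : ∀ s, ∑ x, a x (parity s x) * u s
      = ∑ x, ∑ y, (1 / 2) * (a x y * u s) + u s * ∑ x, character s x * d x := by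
    intro s
    rw [Finset.mul_sum, ← Finset.sum_add_distrib]
    refine Finset.sum_congr rfl fun x _ => ?_
    rw [character_eq_parity, Fintype.sum_bool]
    cases parity s x <;> simp [d] <;> ring
  simp_rw [hsplit]
  rw [Finset.sum_add_distrib]
  gcongr
  refine le_trans (Finset.sum_le_sum fun s _ => ?_) key
  calc _ ≤ |u s * ∑ x, character s x * d x| := le_abs_self _
    _ = u s * |∑ x, character s x * d x| := by rw [abs_mul, abs_of_nonneg (hu s)]
    _ ≤ 1 * |∑ x, character s x * d x| := by gcongr; exact hu' s
    _ = _ := one_mul _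

/-- A nonzero string has the parity `b` for exactly half of the sets. -/
theorem sum_parity_eq {x : Fin n → Bool} (hx : ∃ i, x i = true) (b : Bool) :
    ∑ s : Finset (Fin n), (if parity s x = b then (1 : ℝ) else 0) = 2 ^ n / 2 := by
  have h : ∀ s : Finset (Fin n), (if parity s x = b then (1 : ℝ) else 0)
      = (1 / 2) + (if b = true then -1 / 2 else 1 / 2) * character s x := by
    intro s
    rw [character_eq_parity]
    cases parity s x <;> cases b <;> norm_num
  simp_rw [h]
  rw [Finset.sum_add_distrib, ← Finset.mul_sum, sum_character hx]
  simp
  ring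

end Characters

/-! ### Averaging over the hidden set -/

theorem exists_density_of_le {Ω : Type*} [MeasurableSpace Ω] {α ν : Measure Ω} [IsFiniteMeasure ν]
    {C : NNReal} (h : α ≤ C • ν) :
    ∃ f : Ω → NNReal, Measurable f ∧ (∀ ω, f ω ≤ C) ∧ α = ν.withDensity fun ω => f ω := by
  have hfin : IsFiniteMeasure α := ⟨(h _).trans_lt (measure_lt_top _ _)⟩
  have hac : α ≪ ν := (Measure.absolutelyContinuous_of_le h).trans
    (Measure.smul_absolutelyContinuous)
  have hle : α.rnDeriv ν ≤ᵐ[ν] fun _ => (C : ENNReal) := by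
    refine ae_le_of_forall_setLIntegral_le_of_sigmaFinite (Measure.measurable_rnDeriv _ _) ?_
    intro s hs _
    rw [Measure.setLIntegral_rnDeriv hac, setLIntegral_const]
    exact h s
  -- Capping at C changes the density only on a null set and makes the bound hold at every point, as
  -- the pointwise argument needs.
  refine ⟨fun ω => min (α.rnDeriv ν ω).toNNReal C, by fun_prop, fun ω => min_le_right _ _, ?_⟩
  conv_lhs => rw [← Measure.withDensity_rnDeriv_eq α ν hac]
  refine withDensity_congr_ae ?_
  filter_upwards [hle] with ω hω
  have hne : α.rnDeriv ν ω ≠ ⊤ := ne_top_of_le_ne_top ENNReal.coe_ne_top hω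
  rw [min_eq_left, ENNReal.coe_toNNReal hne]
  rwa [← ENNReal.coe_le_coe, ENNReal.coe_toNNReal hne]

/-- All the α x y have bounded densities with respect to one probability measure ν, so
`sum_parity_le` applies at each ω and can be integrated. The reference measure must not depend on
the sample. -/
theorem sum_lintegral_parity_le {n : ℕ} {Ω : Type*} [MeasurableSpace Ω] {ν : Measure Ω}
    [IsProbabilityMeasure ν] {α : (Fin n → Bool) → Bool → Measure Ω} {C : NNReal}
    (hα : ∀ x y, α x y ≤ C • ν) {u : Finset (Fin n) → Ω → ENNReal}
    (hum : ∀ s, Measurable (u s)) (hu : ∀ s ω, u s ω ≤ 1) :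
    ∑ s, ∑ x, ∫⁻ ω, u s ω ∂(α x (parity s x)) ≤
      ∑ s, ∑ x, ∑ y, 2⁻¹ * ∫⁻ ω, u s ω ∂(α x y)
        + ENNReal.ofReal (2 ^ n * √(2 ^ n) * (C / 2)) := by
  choose f hfm hfC hf using fun x y => exists_density_of_le (hα x y)
  have hint : ∀ x y s, ∫⁻ ω, u s ω ∂(α x y) = ∫⁻ ω, f x y ω * u s ω ∂ν := fun x y s => by
    rw [hf, lintegral_withDensity_eq_lintegral_mul _ (by fun_prop) (hum s)]
    rfl
  have hm : ∀ x y s, Measurable fun ω => (f x y ω : ENNReal) * u s ω := fun x y s => by fun_prop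
  simp_rw [hint]
  have hconst : ENNReal.ofReal (2 ^ n * √(2 ^ n) * (C / 2))
      = ∫⁻ _ω, ENNReal.ofReal (2 ^ n * √(2 ^ n) * (C / 2)) ∂ν := by simp
  rw [hconst]
  simp_rw [← lintegral_const_mul _ (hm _ _ _)]
  simp_rw [← lintegral_finsetSum Finset.univ (fun y _ => (hm _ y _).const_mul _)]
  have hm' : ∀ x s, Measurable fun ω => ∑ y, 2⁻¹ * ((f x y ω : ENNReal) * u s ω) := fun x s =>
    Finset.measurable_sum _ fun y _ => (hm x y s).const_mul _
  simp_rw [← lintegral_finsetSum Finset.univ (fun x _ => hm' x _)]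
  simp_rw [← lintegral_finsetSum Finset.univ (fun x _ => hm x _ _)]
  rw [← lintegral_finsetSum Finset.univ (fun s _ => Finset.measurable_sum _ fun x _ => hm x _ s),
    ← lintegral_finsetSum Finset.univ (fun s _ => Finset.measurable_sum _ fun x _ => hm' x s),
    ← lintegral_add_right _ measurable_const]
  refine lintegral_mono fun ω => ?_
  have hpt := sum_parity_le (fun x y => (f x y ω : ℝ)) (fun s => (u s ω).toReal) (C := C)
    (fun x y => NNReal.coe_nonneg _) (fun x y => by exact_mod_cast hfC x y ω)
    (fun s => ENNReal.toReal_nonneg) (fun s => ENNReal.toReal_le_of_le_ofReal zero_le_one (by simpa using hu s ω))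
  have hut : ∀ s, u s ω ≠ ⊤ := fun s => ne_top_of_le_ne_top ENNReal.one_ne_top (hu s ω)
  have hconv : ∀ x y s, (f x y ω : ENNReal) * u s ω
      = ENNReal.ofReal ((f x y ω : ℝ) * (u s ω).toReal) := fun x y s => by
    rw [ENNReal.ofReal_mul (by positivity), ENNReal.ofReal_toReal (hut s), ENNReal.ofReal_coe_nnreal]
  have h2 : (2⁻¹ : ENNReal) = ENNReal.ofReal (1 / 2) := by
    rw [one_div, ENNReal.ofReal_inv_of_pos (by norm_num)]; norm_num
  refine le_trans (le_of_eq ?_) ((ENNReal.ofReal_le_ofReal hpt).trans (le_of_eq ?_))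
  · rw [ENNReal.ofReal_sum_of_nonneg fun s _ => Finset.sum_nonneg fun x _ => by positivity]
    refine Finset.sum_congr rfl fun s _ => ?_
    rw [ENNReal.ofReal_sum_of_nonneg fun x _ => by positivity]
    exact Finset.sum_congr rfl fun x _ => hconv _ _ _
  · rw [ENNReal.ofReal_add (Finset.sum_nonneg fun s _ => Finset.sum_nonneg fun x _ =>
        Finset.sum_nonneg fun y _ => by positivity) (by positivity),
      ENNReal.ofReal_sum_of_nonneg fun s _ => Finset.sum_nonneg fun x _ =>
        Finset.sum_nonneg fun y _ => by positivity]
    congr 1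
    refine Finset.sum_congr rfl fun s _ => ?_
    rw [ENNReal.ofReal_sum_of_nonneg fun x _ => Finset.sum_nonneg fun y _ => by positivity]
    refine Finset.sum_congr rfl fun x _ => ?_
    rw [ENNReal.ofReal_sum_of_nonneg fun y _ => by positivity]
    refine Finset.sum_congr rfl fun y _ => ?_
    rw [ENNReal.ofReal_mul (by norm_num), ← h2, hconv]

/-! ### Isotropic Gaussian measures -/

section Gaussian

variable {ι : Type*} [Fintype ι]

/-- The centred Gaussian measure on `ι → ℝ` with covariance `σ I`. -/
noncomputable abbrev isotropicGaussian (ι : Type*) [Fintype ι] (σ : NNReal) : Measure (ι → ℝ) :=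
  Measure.pi fun _ => gaussianReal 0 σ

/-- The density of `isotropicGaussian ι σ`. -/
noncomputable def isotropicDensity (σ : NNReal) (x : ι → ℝ) : ℝ :=
  (√(2 * Real.pi * σ))⁻¹ ^ Fintype.card ι * Real.exp (-(∑ e, x e ^ 2) / (2 * σ))

theorem measurable_isotropicDensity (σ : NNReal) :
    Measurable (isotropicDensity σ : (ι → ℝ) → ℝ) := by
  unfold isotropicDensity; fun_prop

theorem prod_gaussianPDFReal (σ : NNReal) (x : ι → ℝ) :
    ∏ e, gaussianPDFReal 0 σ (x e) = isotropicDensity σ x := by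
  simp only [gaussianPDFReal, sub_zero, isotropicDensity]
  rw [Finset.prod_mul_distrib, Finset.prod_const, Finset.card_univ, ← Real.exp_sum,
    ← Finset.sum_div, Finset.sum_neg_distrib]

theorem isotropicGaussian_eq_withDensity {σ : NNReal} (hσ : σ ≠ 0) :
    isotropicGaussian ι σ = volume.withDensity fun x => ENNReal.ofReal (isotropicDensity σ x) := by
  refine Measure.pi_eq fun s hs => ?_
  rw [withDensity_apply _ (MeasurableSet.univ_pi hs), volume_pi, Measure.restrict_pi_pi]
  simp_rw [← prod_gaussianPDFReal]
  rw [← ofReal_integral_eq_lintegral_ofReal, integral_fintype_prod_eq_prod]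
  · rw [ENNReal.ofReal_prod_of_nonneg fun i _ => integral_nonneg fun x => gaussianPDFReal_nonneg _ _ _]
    exact Finset.prod_congr rfl fun i _ => (gaussianReal_apply_eq_integral 0 hσ (s i)).symm
  · exact Integrable.fintype_prod fun i => (integrable_gaussianPDFReal 0 σ).restrict
  · exact ae_of_all _ fun x => Finset.prod_nonneg fun i _ => gaussianPDFReal_nonneg _ _ _

/-- Comparison of a transported Gaussian with a Gaussian through the change of variables formula. -/
theorem map_restrict_isotropicGaussian_le {σ₁ σ₂ : NNReal} (h₁ : σ₁ ≠ 0) (h₂ : σ₂ ≠ 0)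
    {s : Set (ι → ℝ)} (hs : MeasurableSet s) {f : (ι → ℝ) → ι → ℝ} (hfm : Measurable f)
    {f' : (ι → ℝ) → (ι → ℝ) →L[ℝ] (ι → ℝ)} (hf : ∀ x ∈ s, HasFDerivWithinAt f (f' x) s x)
    (hinj : Set.InjOn f s) {C : NNReal}
    (hC : ∀ x ∈ s, isotropicDensity σ₁ x ≤ C * (|(f' x).det| * isotropicDensity σ₂ (f x))) :
    ((isotropicGaussian ι σ₁).restrict s).map f ≤ C • isotropicGaussian ι σ₂ := by
  refine Measure.le_iff.mpr fun E hE => ?_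
  have ht : MeasurableSet (f ⁻¹' E ∩ s) := (hfm hE).inter hs
  rw [Measure.map_apply hfm hE, Measure.restrict_apply (hfm hE),
    isotropicGaussian_eq_withDensity h₁, withDensity_apply _ ht, Measure.smul_apply,
    isotropicGaussian_eq_withDensity h₂, withDensity_apply _ hE]
  have hd := (measurable_isotropicDensity (ι := ι) σ₂).ennreal_ofReal
  calc ∫⁻ x in f ⁻¹' E ∩ s, ENNReal.ofReal (isotropicDensity σ₁ x)
      ≤ ∫⁻ x in f ⁻¹' E ∩ s,
          C * (ENNReal.ofReal |(f' x).det| * ENNReal.ofReal (isotropicDensity σ₂ (f x))) := by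
        refine setLIntegral_mono' ht fun x hx => ?_
        rw [← ENNReal.ofReal_mul (abs_nonneg _), ← ENNReal.ofReal_coe_nnreal,
          ← ENNReal.ofReal_mul C.coe_nonneg]
        exact ENNReal.ofReal_le_ofReal (hC x hx.2)
    _ = C * ∫⁻ x in f ⁻¹' E ∩ s,
          ENNReal.ofReal |(f' x).det| * ENNReal.ofReal (isotropicDensity σ₂ (f x)) := by
        rw [lintegral_const_mul' _ _ ENNReal.coe_ne_top]
    _ = C * ∫⁻ x in f '' (f ⁻¹' E ∩ s), ENNReal.ofReal (isotropicDensity σ₂ x) := by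
        rw [lintegral_image_eq_lintegral_abs_det_fderiv_mul volume ht
          (fun x hx => (hf x hx.2).mono Set.inter_subset_right) (hinj.mono Set.inter_subset_right)]
    _ ≤ C * ∫⁻ x in E, ENNReal.ofReal (isotropicDensity σ₂ x) := by
        gcongr
        rintro _ ⟨x, hx, rfl⟩
        exact hx.1

/-- Compare with the Gaussian of variance 2σ, using the identity as transport map. The ratio of
densities is √2^m exp(-|x|²/(4σ)), which is at most (2/e)^{m/2} where |x|² > 2mσ. -/
theorem isotropicGaussian_tail_le {σ : NNReal} (hσ : σ ≠ 0) :
    isotropicGaussian ι σ {x | ∑ e, x e ^ 2 ≤ 2 * Fintype.card ι * σ}ᶜ ≤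
      ENNReal.ofReal ((2 * Real.exp (-1)) ^ ((Fintype.card ι : ℝ) / 2)) := by
  set s : Set (ι → ℝ) := {x | ∑ e, x e ^ 2 ≤ 2 * Fintype.card ι * σ}ᶜ
  have hs : MeasurableSet s := (measurableSet_le (by fun_prop) (by fun_prop)).compl
  have hσ0 : (0 : ℝ) < σ := by positivity
  set C : NNReal := ⟨(2 * Real.exp (-1)) ^ ((Fintype.card ι : ℝ) / 2), by positivity⟩
  have key := map_restrict_isotropicGaussian_le (ι := ι) hσ (σ₂ := 2 * σ) (by positivity) hs
    (f := id) measurable_id (f' := fun _ => ContinuousLinearMap.id ℝ _)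
    (fun x _ => hasFDerivWithinAt_id _ _) Function.injective_id.injOn (C := C) ?_
  · rw [Measure.map_id] at key
    have := key Set.univ
    rw [Measure.restrict_apply_univ, Measure.smul_apply, measure_univ] at this
    refine this.trans (le_of_eq ?_)
    rw [ENNReal.smul_def, smul_eq_mul, mul_one]
    exact (ENNReal.ofReal_eq_coe_nnreal _).symm
  · intro x hx
    have hx' : 2 * Fintype.card ι * (σ : ℝ) < ∑ e, x e ^ 2 := not_le.mp hx
    set m : ℝ := (Fintype.card ι : ℝ) with hm
    have hdet : |(ContinuousLinearMap.id ℝ (ι → ℝ)).det| = 1 := by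
      simp [ContinuousLinearMap.det]
    rw [hdet, one_mul]
    unfold isotropicDensity
    have hpow : (C : ℝ) = √2 ^ Fintype.card ι * Real.exp (-m / 2) := by
      change (2 * Real.exp (-1)) ^ (m / 2) = _
      rw [Real.mul_rpow (by norm_num) (by positivity), ← Real.exp_mul, Real.sqrt_eq_rpow,
        ← Real.rpow_natCast, ← Real.rpow_mul (by norm_num), ← hm]
      congr 2 <;> ring
    have hsq : (√(2 * Real.pi * ((2 * σ : NNReal) : ℝ)))⁻¹ = (√(2 * Real.pi * σ))⁻¹ * (√2)⁻¹ := by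
      rw [← mul_inv, ← Real.sqrt_mul (by positivity)]
      push_cast; congr 2; ring
    have h2 : √2 ^ Fintype.card ι * ((√2)⁻¹ ^ Fintype.card ι) = 1 := by
      rw [← mul_pow, mul_inv_cancel₀ (by positivity), one_pow]
    rw [hsq, hpow, mul_pow]
    simp only [id_eq]
    have : √2 ^ Fintype.card ι * Real.exp (-m / 2) *
        ((√(2 * Real.pi * σ))⁻¹ ^ Fintype.card ι * (√2)⁻¹ ^ Fintype.card ι *
          Real.exp (-(∑ e, x e ^ 2) / (2 * ((2 * σ : NNReal) : ℝ))))
        = (√(2 * Real.pi * σ))⁻¹ ^ Fintype.card ι *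
          (Real.exp (-m / 2) * Real.exp (-(∑ e, x e ^ 2) / (2 * ((2 * σ : NNReal) : ℝ)))) := by
      linear_combination ((√(2 * Real.pi * σ))⁻¹ ^ Fintype.card ι *
        (Real.exp (-m / 2) * Real.exp (-(∑ e, x e ^ 2) / (2 * ((2 * σ : NNReal) : ℝ))))) * h2
    rw [this, ← Real.exp_add]
    gcongr
    push_cast
    rw [div_add_div _ _ (by norm_num) (by positivity), div_le_div_iff₀ (by positivity) (by positivity)]
    nlinarith [mul_pos hσ0 hσ0]

/-! ### Gaussian convolutions -/

theorem charFunDual_isotropicGaussian [DecidableEq ι] (σ : NNReal) (l : StrongDual ℝ (ι → ℝ)) :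
    charFunDual (isotropicGaussian ι σ) l
      = Complex.exp (-((σ * ∑ e, l (Pi.single e 1) ^ 2 : ℝ) : ℂ) / 2) := by
  rw [charFunDual_pi]
  have : ∀ e, charFunDual (gaussianReal 0 σ) (l.comp (.single ℝ (fun _ => ℝ) e))
      = Complex.exp (-((σ * l (Pi.single e 1) ^ 2 : ℝ) : ℂ) / 2) := by
    intro e
    have h1 : charFunDual (gaussianReal 0 σ) (l.comp (.single ℝ (fun _ => ℝ) e))
        = charFun (gaussianReal 0 σ) (l (Pi.single e 1)) := by
      rw [charFunDual_apply, charFun_apply]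
      congr 1
      ext x
      have hx : l (Pi.single e x) = x * l (Pi.single e 1) := by
        rw [← smul_eq_mul, ← map_smul, ← Pi.single_smul, smul_eq_mul, mul_one]
      simp [hx]
      ring_nf
    rw [h1, charFun_gaussianReal]
    congr 1
    push_cast
    ring
  simp_rw [this]
  rw [← Complex.exp_sum]
  congr 1
  push_cast
  rw [Finset.mul_sum, ← Finset.sum_div, Finset.sum_neg_distrib]

/-- Both sides integrate f against a centred Gaussian law. The hypothesis says that the covariance
forms agree, so the characteristic functions and hence the laws do. -/
theorem lintegral_isotropicGaussian_add_eq [DecidableEq ι] {σ₁ σ₂ τ₁ τ₂ : NNReal}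
    {A M : (ι → ℝ) →L[ℝ] (ι → ℝ)}
    (h : ∀ l : StrongDual ℝ (ι → ℝ),
      σ₁ * ∑ e, l (A (Pi.single e 1)) ^ 2 + τ₁ * ∑ e, l (Pi.single e 1) ^ 2
        = σ₂ * ∑ e, l (M (Pi.single e 1)) ^ 2 + τ₂ * ∑ e, l (Pi.single e 1) ^ 2)
    {f : (ι → ℝ) → ENNReal} (hf : Measurable f) :
    ∫⁻ ζ, ∫⁻ δ, f (A ζ + δ) ∂(isotropicGaussian ι τ₁) ∂(isotropicGaussian ι σ₁)
      = ∫⁻ ζ, ∫⁻ δ, f (M ζ + δ) ∂(isotropicGaussian ι τ₂) ∂(isotropicGaussian ι σ₂) := by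
  have hint : ∀ (σ τ : NNReal) (A : (ι → ℝ) →L[ℝ] (ι → ℝ)),
      ∫⁻ ζ, ∫⁻ δ, f (A ζ + δ) ∂(isotropicGaussian ι τ) ∂(isotropicGaussian ι σ)
        = ∫⁻ x, f x ∂(((isotropicGaussian ι σ).map A).conv (isotropicGaussian ι τ)) := by
    intro σ τ A
    rw [Measure.lintegral_conv hf, lintegral_map _ A.continuous.measurable]
    exact Measurable.lintegral_prod_right' (f := fun p : (ι → ℝ) × (ι → ℝ) => f (p.1 + p.2))
      (by fun_prop)
  have hfin : ∀ (σ : NNReal) (A : (ι → ℝ) →L[ℝ] (ι → ℝ)),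
      IsProbabilityMeasure ((isotropicGaussian ι σ).map A) := fun σ A =>
    Measure.isProbabilityMeasure_map A.continuous.measurable.aemeasurable
  rw [hint, hint]
  congr 1
  refine Measure.ext_of_charFunDual (funext fun l => ?_)
  rw [charFunDual_conv, charFunDual_conv, charFunDual_map, charFunDual_map]
  simp_rw [charFunDual_isotropicGaussian]
  rw [← Complex.exp_add, ← Complex.exp_add, ← add_div, ← add_div, ← neg_add, ← neg_add,
    ← Complex.ofReal_add, ← Complex.ofReal_add]
  simp only [ContinuousLinearMap.comp_apply]
  rw [h l]

end Gaussian

/-! ### Perturbations of the identity -/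

section Linear

variable {ι : Type*} [Fintype ι]

theorem injective_of_norm_sub_le {E : Type*} [NormedAddCommGroup E] [NormedSpace ℝ E]
    {A : E →L[ℝ] E} {θ : ℝ} (hθ : θ < 1) (h : ∀ v, ‖A v - v‖ ≤ θ * ‖v‖) :
    Function.Injective A := by
  refine (injective_iff_map_eq_zero A).mpr fun v hv => ?_
  have := h v
  rw [hv, zero_sub, norm_neg] at this
  exact norm_eq_zero.mp (le_antisymm (by nlinarith [norm_nonneg v]) (norm_nonneg v))

theorem mul_norm_le_norm_apply {E : Type*} [NormedAddCommGroup E] [NormedSpace ℝ E]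
    {A : E →L[ℝ] E} {θ : ℝ} (h : ∀ v, ‖A v - v‖ ≤ θ * ‖v‖) (v : E) :
    (1 - θ) * ‖v‖ ≤ ‖A v‖ := by
  have h1 := norm_sub_norm_le v (A v)
  rw [norm_sub_rev] at h1
  linarith [h v]

/-- The image of the unit sup-norm ball contains the ball of radius 1 - θ; comparing volumes bounds
the determinant. -/
theorem pow_le_abs_det {A : (ι → ℝ) →L[ℝ] (ι → ℝ)} {θ : ℝ} (hθ : θ < 1)
    (h : ∀ v, ‖A v - v‖ ≤ θ * ‖v‖) : (1 - θ) ^ Fintype.card ι ≤ |A.det| := by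
  have hsurj : Function.Surjective A :=
    (LinearMap.injective_iff_surjective (f := (A : (ι → ℝ) →ₗ[ℝ] (ι → ℝ)))).mp
      (injective_of_norm_sub_le hθ h)
  have hsub : Metric.ball (0 : ι → ℝ) (1 - θ) ⊆ A '' Metric.ball 0 1 := by
    intro y hy
    obtain ⟨v, rfl⟩ := hsurj y
    refine ⟨v, ?_, rfl⟩
    rw [mem_ball_zero_iff] at hy ⊢
    have := mul_norm_le_norm_apply h v
    nlinarith
  have hvol := measure_mono (μ := volume) hsub
  rw [Measure.addHaar_image_continuousLinearMap, Real.volume_pi_ball _ (by linarith),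
    Real.volume_pi_ball _ one_pos, ← ENNReal.ofReal_mul (abs_nonneg _),
    ENNReal.ofReal_le_ofReal_iff (by positivity), mul_pow, mul_pow, one_pow, mul_one,
    mul_comm] at hvol
  exact le_of_mul_le_mul_right hvol (by positivity)

theorem sum_sq_vecMul_le {K : Matrix ι ι ℝ} {κ : ℝ} (hK : ∀ i j, |K i j| ≤ κ) (t : ι → ℝ) :
    ∑ e, (Matrix.vecMul t K e) ^ 2 ≤ (Fintype.card ι * κ) ^ 2 * ∑ e, t e ^ 2 := by
  have h1 : ∀ e, (Matrix.vecMul t K e) ^ 2 ≤ κ ^ 2 * (Fintype.card ι * ∑ i, t i ^ 2) := by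
    intro e
    have habs : |Matrix.vecMul t K e| ≤ κ * ∑ i, |t i| := by
      rw [Matrix.vecMul, dotProduct, Finset.mul_sum]
      refine (Finset.abs_sum_le_sum_abs _ _).trans (Finset.sum_le_sum fun i _ => ?_)
      rw [abs_mul, mul_comm]
      gcongr
      exact hK i e
    calc (Matrix.vecMul t K e) ^ 2 = |Matrix.vecMul t K e| ^ 2 := (sq_abs _).symm
      _ ≤ (κ * ∑ i, |t i|) ^ 2 := by gcongr
      _ = κ ^ 2 * (∑ i, |t i|) ^ 2 := mul_pow _ _ _
      _ ≤ κ ^ 2 * (Fintype.card ι * ∑ i, |t i| ^ 2) := by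
        gcongr; exact sq_sum_le_card_mul_sum_sq
      _ = _ := by simp_rw [sq_abs]
  refine (Finset.sum_le_sum fun e _ => h1 e).trans (le_of_eq ?_)
  rw [Finset.sum_const, Finset.card_univ, nsmul_eq_mul]
  ring

/-- The reverse triangle inequality in ℓ², squared. -/
theorem le_sum_sq_sub {q : ℝ} (hq : 0 ≤ q) (hq' : q ≤ 1) {t k : ι → ℝ}
    (h : ∑ e, k e ^ 2 ≤ q ^ 2 * ∑ e, t e ^ 2) :
    (1 - q) ^ 2 * ∑ e, t e ^ 2 ≤ ∑ e, (t e - k e) ^ 2 := by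
  have hexp : ∑ e, (t e - k e) ^ 2 = ∑ e, t e ^ 2 - 2 * ∑ e, t e * k e + ∑ e, k e ^ 2 := by
    rw [Finset.mul_sum, ← Finset.sum_sub_distrib, ← Finset.sum_add_distrib]
    exact Finset.sum_congr rfl fun e _ => by ring
  have hcs := Real.sum_mul_le_sqrt_mul_sqrt Finset.univ t k
  set a := √(∑ e, t e ^ 2)
  set b := √(∑ e, k e ^ 2) with hb
  have ha2 : ∑ e, t e ^ 2 = a ^ 2 := (Real.sq_sqrt (Finset.sum_nonneg fun e _ => sq_nonneg _)).symm
  have hb2 : ∑ e, k e ^ 2 = b ^ 2 := (Real.sq_sqrt (Finset.sum_nonneg fun e _ => sq_nonneg _)).symm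
  have ha : 0 ≤ a := Real.sqrt_nonneg _
  rw [ha2, hb2] at h
  have hba : b ≤ q * a := by
    rw [← mul_pow] at h
    exact (abs_le_of_sq_le_sq' h (by positivity)).2
  rw [hexp, ha2, hb2]
  have h2 : (1 - q) * a ≤ a - b := by linarith
  have h3 : 0 ≤ (1 - q) * a := mul_nonneg (by linarith) ha
  nlinarith [mul_le_mul h2 h2 h3 (h3.trans h2)]

/-- The matrix (1-K)(1-K)ᵀ - (1-q)² I, with q = `Fintype.card ι * κ`, is positive semidefinite
because multiplication by K has ℓ² norm at most q; factoring it gives M. Thus a Gaussian transformed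
by 1 - K still contains an isotropic component of variance factor (1-q)². -/
theorem exists_gram_complement [DecidableEq ι] {K : Matrix ι ι ℝ} {κ : ℝ} (hκ : 0 ≤ κ)
    (hq : Fintype.card ι * κ ≤ 1) (hK : ∀ i j, |K i j| ≤ κ) :
    ∃ M : Matrix ι ι ℝ, ∀ t : ι → ℝ, ∑ e, (Matrix.vecMul t (1 - K) e) ^ 2 =
      (1 - Fintype.card ι * κ) ^ 2 * ∑ e, t e ^ 2 + ∑ e, (Matrix.vecMul t M e) ^ 2 := by
  set q : ℝ := Fintype.card ι * κ
  have hquad : ∀ (N : Matrix ι ι ℝ) (t : ι → ℝ),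
      ∑ e, (Matrix.vecMul t N e) ^ 2 = t ⬝ᵥ Matrix.mulVec (N * N.transpose) t := by
    intro N t
    rw [← Matrix.mulVec_mulVec, Matrix.dotProduct_mulVec, Matrix.mulVec_transpose, dotProduct]
    exact Finset.sum_congr rfl fun e _ => sq _
  set P : Matrix ι ι ℝ := (1 - K) * (1 - K).transpose - (1 - q) ^ 2 • (1 : Matrix ι ι ℝ) with hP
  have hPquad : ∀ t : ι → ℝ, t ⬝ᵥ Matrix.mulVec P t
      = ∑ e, (Matrix.vecMul t (1 - K) e) ^ 2 - (1 - q) ^ 2 * ∑ e, t e ^ 2 := by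
    intro t
    rw [hP, Matrix.sub_mulVec, dotProduct_sub, ← hquad, Matrix.smul_mulVec, Matrix.one_mulVec,
      dotProduct_smul, smul_eq_mul, dotProduct]
    simp_rw [← sq]
  have hpsd : P.PosSemidef := by
    refine .of_dotProduct_mulVec_nonneg ?_ fun t => ?_
    · simp [hP, Matrix.IsHermitian, Matrix.conjTranspose_eq_transpose_of_trivial,
        Matrix.transpose_sub]
    · rw [star_trivial, hPquad, sub_nonneg]
      have := le_sum_sq_sub (by positivity) hq (sum_sq_vecMul_le hK t)
      simpa [Matrix.vecMul_sub] using this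
  obtain ⟨B, hB⟩ : ∃ B : Matrix ι ι ℝ, P = star B * B := by
    open scoped MatrixOrder Matrix.Norms.L2Operator in
    exact CStarAlgebra.nonneg_iff_eq_star_mul_self.mp hpsd.nonneg
  refine ⟨B.transpose, fun t => ?_⟩
  rw [hquad B.transpose, Matrix.transpose_transpose,
    show B.transpose * B = P by
      rw [hB, Matrix.star_eq_conjTranspose, Matrix.conjTranspose_eq_transpose_of_trivial], hPquad]
  ring

end Linear

/-! ### Gradient steps applied to a Gaussian -/

section GradientStep

variable {ι : Type*} [Fintype ι]

/-- The ball which carries most of the mass of `isotropicGaussian ι σ`. -/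
def gaussianBall (ι : Type*) [Fintype ι] (σ : NNReal) : Set (ι → ℝ) :=
  {x | ∑ e, x e ^ 2 ≤ 2 * Fintype.card ι * σ}

theorem measurableSet_gaussianBall (σ : NNReal) : MeasurableSet (gaussianBall ι σ) :=
  measurableSet_le (by fun_prop) (by fun_prop)

theorem zero_mem_gaussianBall (σ : NNReal) : (0 : ι → ℝ) ∈ gaussianBall ι σ := by
  simp [gaussianBall]
  positivity

theorem convex_gaussianBall (σ : NNReal) : Convex ℝ (gaussianBall ι σ) := by
  intro x hx y hy a b ha hb hab
  simp only [gaussianBall, Set.mem_ofPred_eq] at *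
  calc ∑ e, (a • x + b • y) e ^ 2 ≤ ∑ e, (a * x e ^ 2 + b * y e ^ 2) := by
        refine Finset.sum_le_sum fun e _ => ?_
        simp only [Pi.add_apply, Pi.smul_apply, smul_eq_mul]
        obtain rfl : b = 1 - a := by linarith
        nlinarith [mul_nonneg (mul_nonneg ha hb) (sq_nonneg (x e - y e))]
    _ = a * ∑ e, x e ^ 2 + b * ∑ e, y e ^ 2 := by
        rw [Finset.sum_add_distrib, Finset.mul_sum, Finset.mul_sum]
    _ ≤ a * (2 * Fintype.card ι * σ) + b * (2 * Fintype.card ι * σ) := by gcongr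
    _ = _ := by rw [← add_mul, hab, one_mul]

/-- A bound for the `ℓ¹` norm on `gaussianBall ι σ`. -/
noncomputable def gaussianRadius (ι : Type*) [Fintype ι] (σ : NNReal) : ℝ :=
  Fintype.card ι * √(2 * σ)

theorem gaussianRadius_nonneg (σ : NNReal) : 0 ≤ gaussianRadius ι σ := by
  unfold gaussianRadius; positivity

theorem sum_abs_le_gaussianRadius {σ : NNReal} {x : ι → ℝ} (hx : x ∈ gaussianBall ι σ) :
    ∑ e, |x e| ≤ gaussianRadius ι σ := by
  have hx' : ∑ e, x e ^ 2 ≤ 2 * Fintype.card ι * σ := hx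
  refine (abs_le_of_sq_le_sq' ?_ (gaussianRadius_nonneg σ)).2
  calc (∑ e, |x e|) ^ 2 ≤ Fintype.card ι * ∑ e, |x e| ^ 2 := sq_sum_le_card_mul_sum_sq
    _ = Fintype.card ι * ∑ e, x e ^ 2 := by simp_rw [sq_abs]
    _ ≤ Fintype.card ι * (2 * Fintype.card ι * σ) := by gcongr
    _ = gaussianRadius ι σ ^ 2 := by
      rw [gaussianRadius, mul_pow, Real.sq_sqrt (by positivity)]; ring

theorem abs_apply_le_gaussianRadius {σ : NNReal} {x : ι → ℝ} (hx : x ∈ gaussianBall ι σ) (e : ι) :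
    |x e| ≤ gaussianRadius ι σ :=
  (Finset.single_le_sum (f := fun e => |x e|) (fun _ _ => abs_nonneg _)
    (Finset.mem_univ e)).trans (sum_abs_le_gaussianRadius hx)

/-- The mean value inequality along a segment, with sup-norm bounds on the gradient paired with the
ℓ¹ distance. -/
theorem abs_sub_le_of_abs_partial_le [DecidableEq ι] {s : Set (ι → ℝ)} (hs : Convex ℝ s)
    {h : (ι → ℝ) → ℝ} {h' : (ι → ℝ) → (ι → ℝ) →L[ℝ] ℝ} (hd : ∀ x ∈ s, HasFDerivAt h (h' x) x)
    {K : ℝ} (hK : ∀ x ∈ s, ∀ e, |h' x (Pi.single e 1)| ≤ K) {x y : ι → ℝ} (hx : x ∈ s)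
    (hy : y ∈ s) : |h y - h x| ≤ K * ∑ e, |y e - x e| := by
  have hmem : ∀ t ∈ Set.Icc (0 : ℝ) 1, x + t • (y - x) ∈ s := fun t ht =>
    hs.add_smul_sub_mem hx hy ht
  have hder : ∀ t ∈ Set.Icc (0 : ℝ) 1, HasDerivWithinAt (fun t : ℝ => h (x + t • (y - x)))
      (h' (x + t • (y - x)) (y - x)) (Set.Icc 0 1) t := by
    intro t ht
    have hline : HasDerivAt (fun t : ℝ => x + t • (y - x)) (y - x) t := by
      simpa using ((hasDerivAt_id t).smul_const (y - x)).const_add x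
    exact ((hd _ (hmem t ht)).comp_hasDerivAt t hline).hasDerivWithinAt
  have hbound : ∀ t ∈ Set.Icc (0 : ℝ) 1,
      ‖h' (x + t • (y - x)) (y - x)‖ ≤ K * ∑ e, |y e - x e| := by
    intro t ht
    have hv : y - x = ∑ e, (y e - x e) • (Pi.single e 1 : ι → ℝ) := by
      ext i
      simp [Finset.sum_apply, Pi.single_apply]
    rw [hv, map_sum, Finset.mul_sum, Real.norm_eq_abs]
    refine (Finset.abs_sum_le_sum_abs _ _).trans (Finset.sum_le_sum fun e _ => ?_)
    rw [map_smul, smul_eq_mul, abs_mul, mul_comm]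
    rw [← hv]
    gcongr
    exact hK _ (hmem t ht) e
  have := (convex_Icc (0 : ℝ) 1).norm_image_sub_le_of_norm_hasDerivWithin_le hder hbound
    (Set.left_mem_Icc.mpr zero_le_one) (Set.right_mem_Icc.mpr zero_le_one)
  simpa using this

theorem abs_mulVec_le {K : Matrix ι ι ℝ} {κ : ℝ} (hK : ∀ i j, |K i j| ≤ κ) (v : ι → ℝ) (e : ι) :
    |Matrix.mulVec K v e| ≤ κ * ∑ j, |v j| := by
  rw [Matrix.mulVec, dotProduct, Finset.mul_sum]
  refine (Finset.abs_sum_le_sum_abs _ _).trans (Finset.sum_le_sum fun i _ => ?_)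
  rw [abs_mul]
  gcongr
  exact hK e i

theorem norm_mulVec_le {K : Matrix ι ι ℝ} {κ : ℝ} (hκ : 0 ≤ κ) (hK : ∀ i j, |K i j| ≤ κ)
    (v : ι → ℝ) : ‖Matrix.mulVec K v‖ ≤ Fintype.card ι * κ * ‖v‖ := by
  refine (pi_norm_le_iff_of_nonneg (by positivity)).mpr fun e => (abs_mulVec_le hK v e).trans ?_
  have : ∑ j, |v j| ≤ Fintype.card ι * ‖v‖ := by
    have := Finset.sum_le_card_nsmul Finset.univ (fun j => |v j|) ‖v‖ fun j _ => norm_le_pi_norm v j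
    simpa using this
  calc κ * ∑ j, |v j| ≤ κ * (Fintype.card ι * ‖v‖) := by gcongr
    _ = _ := by ring

variable [DecidableEq ι]

/-- The continuous linear map given by a square matrix. -/
noncomputable def matrixCLM (A : Matrix ι ι ℝ) : (ι → ℝ) →L[ℝ] (ι → ℝ) :=
  LinearMap.toContinuousLinearMap (Matrix.toLin' A)

@[simp]
theorem matrixCLM_apply (A : Matrix ι ι ℝ) (v : ι → ℝ) : matrixCLM A v = Matrix.mulVec A v := rfl

/-- The vector field `G`, with Jacobian `H`, is bounded together with its Jacobian by `B` on
`gaussianBall ι σ`, and its Jacobian is within `Λ` of its value at the centre. -/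
structure ControlledField (σ : NNReal) (B Λ : ℝ) (G : (ι → ℝ) → ι → ℝ)
    (H : (ι → ℝ) → Matrix ι ι ℝ) : Prop where
  measurable : Measurable G
  hasFDerivAt : ∀ x ∈ gaussianBall ι σ, HasFDerivAt G (matrixCLM (H x)) x
  abs_le : ∀ x ∈ gaussianBall ι σ, ∀ e, |G x e| ≤ B
  abs_jacobian_le : ∀ x ∈ gaussianBall ι σ, ∀ i j, |H x i j| ≤ B
  abs_jacobian_sub_le : ∀ x ∈ gaussianBall ι σ, ∀ i j, |H x i j - H 0 i j| ≤ Λ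

namespace ControlledField

variable {σ : NNReal} {B Λ γ : ℝ} {G : (ι → ℝ) → ι → ℝ} {H : (ι → ℝ) → Matrix ι ι ℝ}

theorem abs_sub_le (h : ControlledField σ B Λ G H) {x y : ι → ℝ} (hx : x ∈ gaussianBall ι σ)
    (hy : y ∈ gaussianBall ι σ) (e : ι) : |G y e - G x e| ≤ B * ∑ j, |y j - x j| := by
  refine abs_sub_le_of_abs_partial_le (convex_gaussianBall σ) (h := fun x => G x e)
    (h' := fun x => (ContinuousLinearMap.proj e).comp (matrixCLM (H x)))
    (fun x hx => hasFDerivAt_pi'.mp (h.hasFDerivAt x hx) e) (fun x hx j => ?_) hx hy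
  simpa using h.abs_jacobian_le x hx e j

/-- If two points have the same image, their ℓ¹ distance is at most mγB < 1 times itself, where m is
the dimension. -/
theorem injOn (h : ControlledField σ B Λ G H) (hγ : 0 ≤ γ) (hq : Fintype.card ι * (γ * B) < 1) :
    Set.InjOn (fun x => x - γ • G x) (gaussianBall ι σ) := by
  intro x hx y hy hxy
  have h1 : ∀ e, |y e - x e| ≤ γ * B * ∑ j, |y j - x j| := by
    intro e
    have he := congrFun hxy e
    simp only [Pi.sub_apply, Pi.smul_apply, smul_eq_mul] at he
    have : y e - x e = γ * (G y e - G x e) := by linarith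
    rw [this, abs_mul, abs_of_nonneg hγ, mul_assoc]
    gcongr
    exact h.abs_sub_le hx hy e
  have h2 : ∑ e, |y e - x e| ≤ Fintype.card ι * (γ * B) * ∑ j, |y j - x j| := by
    have := Finset.sum_le_sum fun e (_ : e ∈ Finset.univ) => h1 e
    rw [Finset.sum_const, Finset.card_univ, nsmul_eq_mul] at this
    linarith
  have h0 : 0 ≤ ∑ e, |y e - x e| := Finset.sum_nonneg fun _ _ => abs_nonneg _
  have h3 : ∑ e, |y e - x e| = 0 := le_antisymm (by nlinarith) h0
  ext e
  have := (Finset.sum_eq_zero_iff_of_nonneg fun _ _ => abs_nonneg _).mp h3 e (Finset.mem_univ e)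
  linarith [abs_eq_zero.mp this]

theorem hasFDerivAt_step (h : ControlledField σ B Λ G H) (γ : ℝ) {x : ι → ℝ}
    (hx : x ∈ gaussianBall ι σ) :
    HasFDerivAt (fun x => x - γ • G x) (matrixCLM (1 - γ • H x)) x := by
  have := (hasFDerivAt_id x).sub ((h.hasFDerivAt x hx).const_smul γ)
  refine this.congr_fderiv ?_
  ext v e
  simp [Matrix.sub_mulVec, Matrix.smul_mulVec]

theorem norm_jacobian_step_sub_le (h : ControlledField σ B Λ G H) (hγ : 0 ≤ γ) (hB : 0 ≤ B)
    {x : ι → ℝ} (hx : x ∈ gaussianBall ι σ) (v : ι → ℝ) :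
    ‖matrixCLM (1 - γ • H x) v - v‖ ≤ Fintype.card ι * (γ * B) * ‖v‖ := by
  have : matrixCLM (1 - γ • H x) v - v = - Matrix.mulVec (γ • H x) v := by
    rw [matrixCLM_apply, Matrix.sub_mulVec, Matrix.one_mulVec]; abel
  rw [this, norm_neg]
  refine norm_mulVec_le (by positivity) (fun i j => ?_) v
  rw [Matrix.smul_apply, smul_eq_mul, abs_mul, abs_of_nonneg hγ]
  gcongr
  exact h.abs_jacobian_le x hx i j

theorem measurable_step (h : ControlledField σ B Λ G H) (γ : ℝ) :
    Measurable fun x => x - γ • G x :=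
  measurable_id.sub (h.measurable.const_smul γ)

/-- A gradient step increases the density of a Gaussian at most by an explicit factor, up to a
slight increase of its variance. -/
theorem map_step_le (h : ControlledField σ B Λ G H) (hσ : σ ≠ 0) (hγ : 0 ≤ γ) (hB : 0 ≤ B)
    (hq : Fintype.card ι * (γ * B) < 1) {ε : NNReal} (hε : ε ≠ 0) {C : NNReal}
    (hC : √(1 + ε) ^ Fintype.card ι * Real.exp (Fintype.card ι * (γ * B) ^ 2 / (2 * ε * σ))
      ≤ C * (1 - Fintype.card ι * (γ * B)) ^ Fintype.card ι) :
    ((isotropicGaussian ι σ).restrict (gaussianBall ι σ)).map (fun x => x - γ • G x)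
      ≤ C • isotropicGaussian ι ((1 + ε) * σ) := by
  have hσ0 : (0 : ℝ) < σ := by positivity
  have hε0 : (0 : ℝ) < ε := by positivity
  refine map_restrict_isotropicGaussian_le hσ (by positivity) (measurableSet_gaussianBall σ)
    (h.measurable_step γ) (fun x hx => (h.hasFDerivAt_step γ hx).hasFDerivWithinAt)
    (h.injOn hγ hq) fun x hx => ?_
  have hdet := pow_le_abs_det hq (h.norm_jacobian_step_sub_le hγ hB hx)
  set m := Fintype.card ι
  have hsq : (√(2 * Real.pi * σ))⁻¹
      = √(1 + ε) * (√(2 * Real.pi * (((1 + ε) * σ : NNReal) : ℝ)))⁻¹ := by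
    have : 2 * Real.pi * (((1 + ε) * σ : NNReal) : ℝ) = (1 + ε) * (2 * Real.pi * σ) := by
      push_cast; ring
    rw [this, Real.sqrt_mul (show (0 : ℝ) ≤ 1 + ε by positivity), mul_inv, ← mul_assoc, mul_inv_cancel₀ (by positivity),
      one_mul]
  have hexp : -(∑ e, x e ^ 2) / (2 * σ) ≤ m * (γ * B) ^ 2 / (2 * ε * σ)
      + -(∑ e, (x - γ • G x) e ^ 2) / (2 * (((1 + ε) * σ : NNReal) : ℝ)) := by
    have h1 : ∑ e, (x - γ • G x) e ^ 2
        ≤ (1 + ε) * ∑ e, x e ^ 2 + (1 + 1 / (ε : ℝ)) * (m * (γ * B) ^ 2) := by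
      have : ∀ e, (x - γ • G x) e ^ 2
          ≤ (1 + ε) * x e ^ 2 + (1 + 1 / (ε : ℝ)) * (γ * B) ^ 2 := by
        intro e
        simp only [Pi.sub_apply, Pi.smul_apply, smul_eq_mul]
        have hg : (γ * G x e) ^ 2 ≤ (γ * B) ^ 2 := by
          rw [mul_pow, mul_pow]
          exact mul_le_mul_of_nonneg_left
            (sq_le_sq' (by linarith [neg_abs_le (G x e), h.abs_le x hx e])
              (by linarith [le_abs_self (G x e), h.abs_le x hx e])) (sq_nonneg γ)
        -- Young's inequality: the deficit is a perfect square divided by ε. The extra variance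
        -- factor 1 + ε exists to absorb the cross term.
        have h2 : (x e - γ * G x e) ^ 2
            ≤ (1 + ε) * x e ^ 2 + (1 + 1 / (ε : ℝ)) * (γ * G x e) ^ 2 := by
          have h3 : (1 + ε) * x e ^ 2 + (1 + 1 / (ε : ℝ)) * (γ * G x e) ^ 2
              - (x e - γ * G x e) ^ 2 = (ε * x e + γ * G x e) ^ 2 / ε := by
            field_simp; ring
          have h4 : 0 ≤ (ε * x e + γ * G x e) ^ 2 / (ε : ℝ) := by positivity
          linarith
        have h5 : (0 : ℝ) ≤ 1 + 1 / (ε : ℝ) := by positivity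
        nlinarith
      refine (Finset.sum_le_sum fun e _ => this e).trans (le_of_eq ?_)
      rw [Finset.sum_add_distrib, ← Finset.mul_sum, Finset.sum_const, Finset.card_univ,
        nsmul_eq_mul]
      ring
    push_cast
    have h2 : m * (γ * B) ^ 2 / (2 * ε * σ)
        = (1 + 1 / (ε : ℝ)) * (m * (γ * B) ^ 2) / (2 * ((1 + ε) * σ)) := by
      field_simp
      ring
    have h3 : -(∑ e, x e ^ 2) / (2 * (σ : ℝ))
        = -((1 + ε) * ∑ e, x e ^ 2) / (2 * ((1 + ε) * σ)) := by
      field_simp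
    rw [h2, h3, ← add_div]
    gcongr
    linarith
  have hnn : 0 ≤ (√(2 * Real.pi * (((1 + ε) * σ : NNReal) : ℝ)))⁻¹ := by positivity
  unfold isotropicDensity
  rw [hsq, mul_pow]
  calc √(1 + ε) ^ m * (√(2 * Real.pi * (((1 + ε) * σ : NNReal) : ℝ)))⁻¹ ^ m
        * Real.exp (-(∑ e, x e ^ 2) / (2 * σ))
      ≤ √(1 + ε) ^ m * (√(2 * Real.pi * (((1 + ε) * σ : NNReal) : ℝ)))⁻¹ ^ m
        * Real.exp (m * (γ * B) ^ 2 / (2 * ε * σ)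
          + -(∑ e, (x - γ • G x) e ^ 2) / (2 * (((1 + ε) * σ : NNReal) : ℝ))) := by
        gcongr
    _ = (√(1 + ε) ^ m * Real.exp (m * (γ * B) ^ 2 / (2 * ε * σ)))
        * ((√(2 * Real.pi * (((1 + ε) * σ : NNReal) : ℝ)))⁻¹ ^ m
          * Real.exp (-(∑ e, (x - γ • G x) e ^ 2) / (2 * (((1 + ε) * σ : NNReal) : ℝ)))) := by
        rw [Real.exp_add]; ring
    _ ≤ (C * |(matrixCLM (1 - γ • H x)).det|)
        * ((√(2 * Real.pi * (((1 + ε) * σ : NNReal) : ℝ)))⁻¹ ^ m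
          * Real.exp (-(∑ e, (x - γ • G x) e ^ 2) / (2 * (((1 + ε) * σ : NNReal) : ℝ)))) := by
        refine mul_le_mul_of_nonneg_right (hC.trans ?_) (by positivity)
        gcongr
    _ = _ := by ring

/-- The difference between a gradient step and its linearization at the centre. -/
theorem abs_remainder_le (h : ControlledField σ B Λ G H) (hγ : 0 ≤ γ) (hΛ : 0 ≤ Λ) {x : ι → ℝ}
    (hx : x ∈ gaussianBall ι σ) (e : ι) :
    |(x - γ • G x) e - (0 - γ • G 0) e - Matrix.mulVec (1 - γ • H 0) x e|
      ≤ γ * Λ * gaussianRadius ι σ := by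
  have hd : ∀ y ∈ gaussianBall ι σ,
      HasFDerivAt (fun y : ι → ℝ => (y - γ • G y) e - matrixCLM (1 - γ • H 0) y e)
        ((ContinuousLinearMap.proj e).comp
          (matrixCLM (1 - γ • H y) - matrixCLM (1 - γ • H 0))) y := by
    intro y hy
    have := (h.hasFDerivAt_step γ hy).sub (matrixCLM (1 - γ • H 0)).hasFDerivAt
    exact hasFDerivAt_pi'.mp this e
  have hK : ∀ y ∈ gaussianBall ι σ, ∀ j, |((ContinuousLinearMap.proj e).comp
      (matrixCLM (1 - γ • H y) - matrixCLM (1 - γ • H 0)) : (ι → ℝ) →L[ℝ] ℝ) (Pi.single j 1)|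
      ≤ γ * Λ := by
    intro y hy j
    have : ((ContinuousLinearMap.proj e).comp
        (matrixCLM (1 - γ • H y) - matrixCLM (1 - γ • H 0)) : (ι → ℝ) →L[ℝ] ℝ) (Pi.single j 1)
        = -(γ * (H y e j - H 0 e j)) := by
      simp
      ring
    rw [this, abs_neg, abs_mul, abs_of_nonneg hγ]
    gcongr
    exact h.abs_jacobian_sub_le y hy e j
  have := abs_sub_le_of_abs_partial_le (convex_gaussianBall σ) hd hK (zero_mem_gaussianBall σ) hx
  have hs := sum_abs_le_gaussianRadius hx
  simp only [matrixCLM_apply, Matrix.mulVec_zero, Pi.zero_apply, sub_zero] at this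
  calc _ = |(x - γ • G x) e - Matrix.mulVec (1 - γ • H 0) x e - (0 - γ • G 0) e| := by
        congr 1; ring
    _ ≤ _ := this
    _ ≤ _ := by gcongr

/-- A gradient step applied to a Gaussian is close to its linearization at the centre. -/
theorem lintegral_step_le (h : ControlledField σ B Λ G H) (hσ : σ ≠ 0) (hγ : 0 ≤ γ) (hB : 0 ≤ B)
    (hΛ : 0 ≤ Λ) (hq : Fintype.card ι * (γ * B) < 1) {Z θ : ℝ}
    (hZ : γ * Λ * gaussianRadius ι σ / (1 - Fintype.card ι * (γ * B)) = Z)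
    (hθ : Fintype.card ι * (γ * Λ) / (1 - Fintype.card ι * (γ * B)) = θ) (hθ' : θ < 1)
    {C : NNReal} (hC : Real.exp ((2 * gaussianRadius ι σ * Z + Fintype.card ι * Z ^ 2) / (2 * σ))
      ≤ C * (1 - θ) ^ Fintype.card ι) {g : (ι → ℝ) → ENNReal} (hg : Measurable g) :
    ∫⁻ x in gaussianBall ι σ, g (x - γ • G x) ∂(isotropicGaussian ι σ)
      ≤ C * ∫⁻ x, g ((0 - γ • G 0) + matrixCLM (1 - γ • H 0) x) ∂(isotropicGaussian ι σ) := by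
  have hσ0 : (0 : ℝ) < σ := by positivity
  have h1q : 0 < 1 - Fintype.card ι * (γ * B) := by linarith
  have hρ := gaussianRadius_nonneg (ι := ι) σ
  have hZ0 : 0 ≤ Z := by rw [← hZ]; positivity
  set A := matrixCLM (1 - γ • H 0) with hA
  have hAn := h.norm_jacobian_step_sub_le hγ hB (zero_mem_gaussianBall σ)
  let Ae : (ι → ℝ) ≃L[ℝ] (ι → ℝ) := (LinearEquiv.ofInjectiveEndo (A : (ι → ℝ) →ₗ[ℝ] (ι → ℝ))
    (injective_of_norm_sub_le hq hAn)).toContinuousLinearEquiv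
  have hAe : ∀ v, Ae v = A v := fun v => rfl
  have hinv : ∀ v, ‖Ae.symm v‖ ≤ ‖v‖ / (1 - Fintype.card ι * (γ * B)) := by
    intro v
    rw [le_div_iff₀ h1q, mul_comm]
    have := mul_norm_le_norm_apply hAn (Ae.symm v)
    rwa [← hA, ← hAe, Ae.apply_symm_apply] at this
  set f : (ι → ℝ) → ι → ℝ := fun x => x - γ • G x with hf
  -- Factor the step as the affine linearization after ψ. It then suffices to compare the Gaussian
  -- with its image under ψ, a map close to the identity.
  set ψ : (ι → ℝ) → ι → ℝ := fun x => Ae.symm (f x - (0 - γ • G 0)) with hψ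
  have hfψ : ∀ x, f x = (0 - γ • G 0) + A (ψ x) := by
    intro x
    rw [hψ, ← hAe, Ae.apply_symm_apply]
    abel
  have hψm : Measurable ψ := Ae.symm.continuous.measurable.comp
    ((h.measurable_step γ).sub_const _)
  have hψd : ∀ x ∈ gaussianBall ι σ, HasFDerivAt ψ
      ((Ae.symm : (ι → ℝ) →L[ℝ] (ι → ℝ)).comp (matrixCLM (1 - γ • H x))) x := by
    intro x hx
    exact (Ae.symm : (ι → ℝ) →L[ℝ] (ι → ℝ)).hasFDerivAt.comp x
      ((h.hasFDerivAt_step γ hx).sub_const _)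
  have hψinj : Set.InjOn ψ (gaussianBall ι σ) := by
    intro x hx y hy hxy
    exact h.injOn hγ hq hx hy (by
      have := hfψ x
      rw [hxy, ← hfψ y] at this
      exact this)
  have hmap : ((isotropicGaussian ι σ).restrict (gaussianBall ι σ)).map ψ
      ≤ C • isotropicGaussian ι σ := by
    refine map_restrict_isotropicGaussian_le hσ hσ (measurableSet_gaussianBall σ) hψm
      (fun x hx => (hψd x hx).hasFDerivWithinAt) hψinj fun x hx => ?_
    have hdet : (1 - θ) ^ Fintype.card ι ≤ |((Ae.symm : (ι → ℝ) →L[ℝ] (ι → ℝ)).comp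
        (matrixCLM (1 - γ • H x))).det| := by
      refine pow_le_abs_det hθ' fun v => ?_
      have hv : ((Ae.symm : (ι → ℝ) →L[ℝ] (ι → ℝ)).comp (matrixCLM (1 - γ • H x))) v - v
          = Ae.symm (-(γ • Matrix.mulVec (H x - H 0) v)) := by
        have : v = Ae.symm (A v) := by rw [← hAe, Ae.symm_apply_apply]
        change Ae.symm (matrixCLM (1 - γ • H x) v) - v = _
        conv_lhs => rhs; rw [this]
        rw [← map_sub]
        congr 1
        simp only [hA, matrixCLM_apply, Matrix.sub_mulVec, Matrix.smul_mulVec, smul_sub]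
        abel
      rw [hv]
      refine (hinv _).trans ?_
      rw [← hθ, div_mul_eq_mul_div]
      gcongr
      rw [norm_neg, norm_smul, Real.norm_eq_abs, abs_of_nonneg hγ]
      calc γ * ‖Matrix.mulVec (H x - H 0) v‖ ≤ γ * (Fintype.card ι * Λ * ‖v‖) := by
            gcongr
            exact norm_mulVec_le hΛ (fun i j => h.abs_jacobian_sub_le x hx i j) v
        _ = _ := by ring
    have hz : ∀ e, |ψ x e - x e| ≤ Z := by
      intro e
      -- The displacement of ψ is A⁻¹ applied to the remainder of the linearization, which explains
      -- the value of Z; θ bounds the derivative of the displacement in the same way.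
      have hzx : ψ x - x = Ae.symm (f x - (0 - γ • G 0) - A x) := by
        rw [map_sub, ← hAe x, Ae.symm_apply_apply]
      have h1 : ‖ψ x - x‖ ≤ Z := by
        rw [hzx, ← hZ]
        refine (hinv _).trans ?_
        gcongr
        exact (pi_norm_le_iff_of_nonneg (by positivity)).mpr fun e =>
          h.abs_remainder_le hγ hΛ hx e
      exact (norm_le_pi_norm (ψ x - x) e).trans h1
    have hsum : ∑ e, ψ x e ^ 2
        ≤ ∑ e, x e ^ 2 + (2 * gaussianRadius ι σ * Z + Fintype.card ι * Z ^ 2) := by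
      have he : ∀ e, ψ x e ^ 2 ≤ x e ^ 2 + (2 * Z * |x e| + Z ^ 2) := by
        intro e
        have h1 : (ψ x e - x e) ^ 2 ≤ Z ^ 2 := sq_le_sq' (by linarith [neg_abs_le (ψ x e - x e), hz e])
          ((le_abs_self _).trans (hz e))
        have h2 : x e * (ψ x e - x e) ≤ |x e| * Z := by
          refine (le_abs_self _).trans ?_
          rw [abs_mul]
          gcongr
          exact hz e
        nlinarith
      refine (Finset.sum_le_sum fun e _ => he e).trans ?_
      rw [Finset.sum_add_distrib, Finset.sum_add_distrib, ← Finset.mul_sum, Finset.sum_const,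
        Finset.card_univ, nsmul_eq_mul]
      have := mul_le_mul_of_nonneg_left (sum_abs_le_gaussianRadius hx) hZ0
      linarith
    have hexp : -(∑ e, x e ^ 2) / (2 * σ)
        ≤ (2 * gaussianRadius ι σ * Z + Fintype.card ι * Z ^ 2) / (2 * σ)
          + -(∑ e, ψ x e ^ 2) / (2 * σ) := by
      rw [← add_div]
      gcongr
      linarith
    unfold isotropicDensity
    set c := (√(2 * Real.pi * σ))⁻¹ ^ Fintype.card ι
    have hc : 0 ≤ c := by positivity
    calc c * Real.exp (-(∑ e, x e ^ 2) / (2 * σ))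
        ≤ c * Real.exp ((2 * gaussianRadius ι σ * Z + Fintype.card ι * Z ^ 2) / (2 * σ)
          + -(∑ e, ψ x e ^ 2) / (2 * σ)) := by gcongr
      _ = Real.exp ((2 * gaussianRadius ι σ * Z + Fintype.card ι * Z ^ 2) / (2 * σ))
          * (c * Real.exp (-(∑ e, ψ x e ^ 2) / (2 * σ))) := by rw [Real.exp_add]; ring
      _ ≤ (C * |((Ae.symm : (ι → ℝ) →L[ℝ] (ι → ℝ)).comp (matrixCLM (1 - γ • H x))).det|)
          * (c * Real.exp (-(∑ e, ψ x e ^ 2) / (2 * σ))) := by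
          refine mul_le_mul_of_nonneg_right (hC.trans ?_) (by positivity)
          gcongr
      _ = _ := by ring
  have hg' : Measurable fun y => g ((0 - γ • G 0) + A y) := by fun_prop
  calc ∫⁻ x in gaussianBall ι σ, g (f x) ∂(isotropicGaussian ι σ)
      = ∫⁻ y, g ((0 - γ • G 0) + A y)
          ∂(((isotropicGaussian ι σ).restrict (gaussianBall ι σ)).map ψ) := by
        rw [lintegral_map hg' hψm]
        simp_rw [← hfψ]
    _ ≤ ∫⁻ y, g ((0 - γ • G 0) + A y) ∂(C • isotropicGaussian ι σ) :=
        lintegral_mono' hmap le_rfl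
    _ = _ := by rw [lintegral_smul_measure]; rfl

end ControlledField

end GradientStep

/-! ### One step of killed noisy gradient descent, averaged over the hidden set -/

section AveragedStep

variable {ι : Type*} [Fintype ι]

/-- The value of one step of noisy gradient descent on a random sample labelled with the parity of
`s`, stopped (with value `0`) when the current weights are not in the set `good` of the sample,
followed by the reward `U s`. -/
noncomputable def stepValue {n : ℕ} (σ' : NNReal) (γ : ℝ)
    (G : (Fin n → Bool) → Bool → (ι → ℝ) → ι → ℝ)
    (good : (Fin n → Bool) → Bool → Set (ι → ℝ)) (U : Finset (Fin n) → (ι → ℝ) → ENNReal)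
    (s : Finset (Fin n)) (w : ι → ℝ) : ENNReal :=
  (2 ^ n)⁻¹ * ∑ x, (good x (parity s x)).indicator
    (fun w => ∫⁻ δ, U s (w - γ • G x (parity s x) w + δ) ∂(isotropicGaussian ι σ')) w

theorem measurable_stepValue_term {σ' : NNReal} {γ : ℝ} {g : (ι → ℝ) → ι → ℝ} (hg : Measurable g)
    {U : (ι → ℝ) → ENNReal} (hU : Measurable U) :
    Measurable fun w => ∫⁻ δ, U (w - γ • g w + δ) ∂(isotropicGaussian ι σ') :=
  Measurable.lintegral_prod_right'
    (f := fun p : (ι → ℝ) × (ι → ℝ) => U (p.1 - γ • g p.1 + p.2)) (by fun_prop)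

theorem measurable_stepValue {n : ℕ} {σ' : NNReal} {γ : ℝ}
    {G : (Fin n → Bool) → Bool → (ι → ℝ) → ι → ℝ} (hG : ∀ x y, Measurable (G x y))
    {good : (Fin n → Bool) → Bool → Set (ι → ℝ)} (hgood : ∀ x y, MeasurableSet (good x y))
    {U : Finset (Fin n) → (ι → ℝ) → ENNReal} (hU : ∀ s, Measurable (U s)) (s : Finset (Fin n)) :
    Measurable (stepValue σ' γ G good U s) :=
  (Finset.measurable_sum _ fun x _ =>
    (measurable_stepValue_term (hG x _) (hU s)).indicator (hgood x _)).const_mul _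

theorem lintegral_le_one_of_le_one {Ω : Type*} [MeasurableSpace Ω] {ν : Measure Ω}
    [IsProbabilityMeasure ν] {f : Ω → ENNReal} (hf : ∀ ω, f ω ≤ 1) : ∫⁻ ω, f ω ∂ν ≤ 1 :=
  (lintegral_mono hf).trans (by simp)

theorem stepValue_le_one {n : ℕ} {σ' : NNReal} {γ : ℝ}
    {G : (Fin n → Bool) → Bool → (ι → ℝ) → ι → ℝ}
    {good : (Fin n → Bool) → Bool → Set (ι → ℝ)}
    {U : Finset (Fin n) → (ι → ℝ) → ENNReal} (hU : ∀ s w, U s w ≤ 1) (s : Finset (Fin n))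
    (w : ι → ℝ) : stepValue σ' γ G good U s w ≤ 1 := by
  unfold stepValue
  calc _ ≤ (2 ^ n)⁻¹ * ∑ _x : Fin n → Bool, (1 : ENNReal) := by
        gcongr with x
        exact Set.indicator_le' (fun _ _ => lintegral_le_one_of_le_one fun _ => hU _ _)
          (fun _ _ => zero_le_one) w
    _ = 1 := by
        simp
        exact ENNReal.inv_mul_cancel (by simp) (by simp)

variable [DecidableEq ι]

/-- With A = 1 - γH and q = mγB, m the dimension, one has AAᵀ = (1-q)² I + MMᵀ. As σ' = σ - (1-q)²
σ, the covariance σAAᵀ + σ'I equals σMMᵀ + σI. -/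
theorem exists_lintegral_linear_add_eq {σ σ' : NNReal} {B γ : ℝ} (hγ : 0 ≤ γ) (hB : 0 ≤ B)
    (hq : Fintype.card ι * (γ * B) < 1)
    (hσ' : (σ' : ℝ) = σ - (1 - Fintype.card ι * (γ * B)) ^ 2 * σ)
    {H : Matrix ι ι ℝ} (hH : ∀ i j, |H i j| ≤ B) :
    ∃ M : (ι → ℝ) →L[ℝ] (ι → ℝ), ∀ f : (ι → ℝ) → ENNReal, Measurable f →
      ∫⁻ ζ, ∫⁻ δ, f (matrixCLM (1 - γ • H) ζ + δ) ∂(isotropicGaussian ι σ')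
          ∂(isotropicGaussian ι σ)
        = ∫⁻ ζ, ∫⁻ δ, f (M ζ + δ) ∂(isotropicGaussian ι σ) ∂(isotropicGaussian ι σ) := by
  obtain ⟨M, hM⟩ := exists_gram_complement (K := γ • H) (κ := γ * B) (by positivity) hq.le
    (fun i j => by
      rw [Matrix.smul_apply, smul_eq_mul, abs_mul, abs_of_nonneg hγ]
      gcongr
      exact hH i j)
  refine ⟨matrixCLM M, fun f hf => lintegral_isotropicGaussian_add_eq (fun l => ?_) hf⟩
  have hl : ∀ (N : Matrix ι ι ℝ) (e : ι), l (matrixCLM N (Pi.single e 1))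
      = Matrix.vecMul (fun i => l (Pi.single i 1)) N e := by
    intro N e
    have hv : matrixCLM N (Pi.single e 1) = ∑ i, N i e • (Pi.single i 1 : ι → ℝ) := by
      ext i
      simp [Finset.sum_apply, Pi.single_apply]
    rw [hv, map_sum, Matrix.vecMul, dotProduct]
    exact Finset.sum_congr rfl fun i _ => by rw [map_smul, smul_eq_mul, mul_comm]
  simp_rw [hl, hM, hσ']
  ring

/-- The numerical conditions under which a step of noisy gradient descent is analysed. -/
structure StepConstants (ι : Type*) [Fintype ι] (σ σ' : NNReal) (B γ Λ : ℝ) (C₁ C₂ : NNReal) :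
    Prop where
  var_ne_zero : σ ≠ 0
  rate_nonneg : 0 ≤ γ
  bound_nonneg : 0 ≤ B
  lipschitz_nonneg : 0 ≤ Λ
  contraction : Fintype.card ι * (γ * B) < 1
  noise : (σ' : ℝ) = σ - (1 - Fintype.card ι * (γ * B)) ^ 2 * σ
  domination : ∃ ε : NNReal, ε ≠ 0 ∧
    √(1 + ε) ^ Fintype.card ι * Real.exp (Fintype.card ι * (γ * B) ^ 2 / (2 * ε * σ))
      ≤ C₁ * (1 - Fintype.card ι * (γ * B)) ^ Fintype.card ι
  linearization : ∃ Z θ : ℝ,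
    γ * Λ * gaussianRadius ι σ / (1 - Fintype.card ι * (γ * B)) = Z ∧
    Fintype.card ι * (γ * Λ) / (1 - Fintype.card ι * (γ * B)) = θ ∧ θ < 1 ∧
    Real.exp ((2 * gaussianRadius ι σ * Z + Fintype.card ι * Z ^ 2) / (2 * σ))
      ≤ C₂ * (1 - θ) ^ Fintype.card ι

/-- For a sample that does not depend on s, the linearized step plus noise is a mixture, over ζ, of
Gaussians of covariance σI centred at μ + c + Mζ. Since the mixture is the same for all s, the sum
over s moves inside the integral over ζ and `hV` applies to each component. -/
theorem StepConstants.lintegral_step_le {σ σ' : NNReal} {B γ Λ : ℝ} {C₁ C₂ : NNReal}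
    (hc : StepConstants ι σ σ' B γ Λ C₁ C₂) {G : (ι → ℝ) → ι → ℝ}
    {H : (ι → ℝ) → Matrix ι ι ℝ} (h : ControlledField σ B Λ G H) {κ : Type*} [Fintype κ]
    {U : κ → (ι → ℝ) → ENNReal} (hU : ∀ s, Measurable (U s)) (μ : ι → ℝ) {V : ENNReal}
    (hV : ∀ ν : ι → ℝ, ∑ s, ∫⁻ ξ, U s (ν + ξ) ∂(isotropicGaussian ι σ) ≤ V) :
    ∑ s, ∫⁻ ξ in gaussianBall ι σ, ∫⁻ δ, U s (μ + (ξ - γ • G ξ) + δ) ∂(isotropicGaussian ι σ')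
      ∂(isotropicGaussian ι σ) ≤ C₂ * V := by
  obtain ⟨Z, θ, hZ, hθ, hθ', hC⟩ := hc.linearization
  obtain ⟨M, hM⟩ := exists_lintegral_linear_add_eq (H := H 0) hc.rate_nonneg hc.bound_nonneg
    hc.contraction hc.noise (h.abs_jacobian_le 0 (zero_mem_gaussianBall σ))
  set c := (0 : ι → ℝ) - γ • G 0
  have hm : ∀ s, Measurable fun z : ι → ℝ => ∫⁻ δ, U s (μ + z + δ) ∂(isotropicGaussian ι σ') :=
    fun s => Measurable.lintegral_prod_right'
      (f := fun p : (ι → ℝ) × (ι → ℝ) => U s (μ + p.1 + p.2)) (by fun_prop)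
  have hm' : ∀ s, Measurable fun ζ : ι → ℝ =>
      ∫⁻ ξ, U s ((μ + c + M ζ) + ξ) ∂(isotropicGaussian ι σ) :=
    fun s => Measurable.lintegral_prod_right'
      (f := fun p : (ι → ℝ) × (ι → ℝ) => U s ((μ + c + M p.1) + p.2)) (by fun_prop)
  calc _ ≤ ∑ s, C₂ * ∫⁻ ζ, ∫⁻ δ, U s (μ + (c + matrixCLM (1 - γ • H 0) ζ) + δ)
          ∂(isotropicGaussian ι σ') ∂(isotropicGaussian ι σ) :=
        Finset.sum_le_sum fun s _ => h.lintegral_step_le hc.var_ne_zero hc.rate_nonneg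
          hc.bound_nonneg hc.lipschitz_nonneg hc.contraction hZ hθ hθ' hC (hm s)
    _ = ∑ s, C₂ * ∫⁻ ζ, ∫⁻ ξ, U s ((μ + c + M ζ) + ξ)
          ∂(isotropicGaussian ι σ) ∂(isotropicGaussian ι σ) := by
        refine Finset.sum_congr rfl fun s _ => ?_
        have := hM (fun z => U s (μ + c + z)) (by fun_prop)
        simp only [← add_assoc] at this ⊢
        rw [this]
    _ = C₂ * ∫⁻ ζ, ∑ s, ∫⁻ ξ, U s ((μ + c + M ζ) + ξ)
          ∂(isotropicGaussian ι σ) ∂(isotropicGaussian ι σ) := by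
        rw [lintegral_finsetSum _ fun s _ => hm' s, Finset.mul_sum]
    _ ≤ C₂ * ∫⁻ _ζ, V ∂(isotropicGaussian ι σ) := by
        gcongr with ζ
        exact hV _
    _ = C₂ * V := by simp

/-- Averaged over the hidden set, a step on samples labelled with the hidden parity is hardly better
than a step on samples with random labels, and the latter keeps the weights a mixture of
Gaussians. -/
theorem StepConstants.average_stepValue_le {n : ℕ} {σ σ' : NNReal} {B γ Λ : ℝ} {C₁ C₂ : NNReal}
    (hc : StepConstants ι σ σ' B γ Λ C₁ C₂)
    {G : (Fin n → Bool) → Bool → (ι → ℝ) → ι → ℝ} (hG : ∀ x y, Measurable (G x y))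
    {good : (Fin n → Bool) → Bool → Set (ι → ℝ)} (hgood : ∀ x y, MeasurableSet (good x y))
    (hctrl : ∀ (μ : ι → ℝ) x y, (∃ ξ ∈ gaussianBall ι σ, μ + ξ ∈ good x y) →
      ∃ H, ControlledField σ B Λ (fun ξ => G x y (μ + ξ)) H)
    {U : Finset (Fin n) → (ι → ℝ) → ENNReal} (hU : ∀ s, Measurable (U s)) (hU1 : ∀ s w, U s w ≤ 1)
    {V : ENNReal}
    (hV : ∀ ν : ι → ℝ, (2 ^ n)⁻¹ * ∑ s, ∫⁻ ξ, U s (ν + ξ) ∂(isotropicGaussian ι σ) ≤ V)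
    (μ : ι → ℝ) :
    (2 ^ n)⁻¹ * ∑ s, ∫⁻ ξ, stepValue σ' γ G good U s (μ + ξ) ∂(isotropicGaussian ι σ)
      ≤ C₂ * V + isotropicGaussian ι σ (gaussianBall ι σ)ᶜ
        + ENNReal.ofReal (C₁ / (2 * √(2 ^ n))) := by
  set N : ENNReal := 2 ^ n with hN
  have hN0 : N ≠ 0 := by simp [hN]
  have hNt : N ≠ ⊤ := by simp [hN]
  have hcard : ∀ c : ENNReal, ∑ _x : Fin n → Bool, c = N * c := fun c => by simp [hN]
  have hcard' : ∀ c : ENNReal, ∑ _s : Finset (Fin n), c = N * c := fun c => by simp [hN]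
  have hV' : ∀ ν : ι → ℝ, ∑ s, ∫⁻ ξ, U s (ν + ξ) ∂(isotropicGaussian ι σ) ≤ N * V := fun ν => by
    have := hV ν
    rwa [← ENNReal.div_eq_inv_mul, ENNReal.div_le_iff hN0 hNt, mul_comm] at this
  set t := isotropicGaussian ι σ (gaussianBall ι σ)ᶜ
  set f : (Fin n → Bool) → Bool → (ι → ℝ) → ι → ℝ := fun x y ξ => ξ - γ • G x y (μ + ξ) with hf
  have hfm : ∀ x y, Measurable (f x y) := fun x y => by
    have := hG x y
    fun_prop
  set u : Finset (Fin n) → (ι → ℝ) → ENNReal :=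
    fun s z => ∫⁻ δ, U s (μ + z + δ) ∂(isotropicGaussian ι σ') with hu
  have hum : ∀ s, Measurable (u s) := fun s => Measurable.lintegral_prod_right'
      (f := fun p : (ι → ℝ) × (ι → ℝ) => U s (μ + p.1 + p.2)) (by fun_prop)
  have hu1 : ∀ s z, u s z ≤ 1 := fun s z => lintegral_le_one_of_le_one fun _ => hU1 _ _
  set R : (Fin n → Bool) → Bool → Set (ι → ℝ) :=
    fun x y => gaussianBall ι σ ∩ {ξ | μ + ξ ∈ good x y} with hR
  have hRm : ∀ x y, MeasurableSet {ξ | μ + ξ ∈ good x y} := fun x y =>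
    (measurable_const_add μ) (hgood x y)
  set α : (Fin n → Bool) → Bool → Measure (ι → ℝ) :=
    fun x y => ((isotropicGaussian ι σ).restrict (R x y)).map (f x y) with hα
  have hαint : ∀ x y s, ∫⁻ z, u s z ∂(α x y)
      = ∫⁻ ξ in R x y, u s (f x y ξ) ∂(isotropicGaussian ι σ) := fun x y s =>
    lintegral_map (hum s) (hfm x y)
  obtain ⟨ε, hε, hC₁⟩ := hc.domination
  -- Either some point of the ball is good, which controls the field on the whole ball, or the
  -- restricted measure vanishes.
  have hdom : ∀ x y, α x y ≤ C₁ • isotropicGaussian ι ((1 + ε) * σ) := by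
    intro x y
    by_cases hne : ∃ ξ ∈ gaussianBall ι σ, μ + ξ ∈ good x y
    · obtain ⟨H, hH⟩ := hctrl μ x y hne
      refine le_trans (Measure.map_mono ?_ (hfm x y)) (hH.map_step_le hc.var_ne_zero
        hc.rate_nonneg hc.bound_nonneg hc.contraction hε hC₁)
      exact Measure.restrict_mono Set.inter_subset_left le_rfl
    · have : R x y = ∅ := Set.eq_empty_of_forall_notMem fun ξ hξ => hne ⟨ξ, hξ.1, hξ.2⟩
      simp only [hα, this, Measure.restrict_empty, Measure.map_zero]
      exact Measure.zero_le _
  have hkey := sum_lintegral_parity_le hdom hum hu1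
  have hrand : ∀ x y, ∑ s, ∫⁻ z, u s z ∂(α x y) ≤ C₂ * (N * V) := by
    intro x y
    simp_rw [hαint]
    by_cases hne : ∃ ξ ∈ gaussianBall ι σ, μ + ξ ∈ good x y
    · obtain ⟨H, hH⟩ := hctrl μ x y hne
      refine le_trans (Finset.sum_le_sum fun s _ => ?_) (hc.lintegral_step_le hH hU μ hV')
      exact lintegral_mono_set Set.inter_subset_left
    · have : R x y = ∅ := Set.eq_empty_of_forall_notMem fun ξ hξ => hne ⟨ξ, hξ.1, hξ.2⟩
      simp [this]
  have hreal : ∀ s, ∫⁻ ξ, stepValue σ' γ G good U s (μ + ξ) ∂(isotropicGaussian ι σ)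
      ≤ N⁻¹ * ∑ x, ∫⁻ z, u s z ∂(α x (parity s x)) + t := by
    intro s
    have hterm : ∀ x, Measurable fun ξ => (good x (parity s x)).indicator
        (fun w => ∫⁻ δ, U s (w - γ • G x (parity s x) w + δ) ∂(isotropicGaussian ι σ')) (μ + ξ) :=
      fun x => ((measurable_stepValue_term (hG x _) (hU s)).indicator (hgood x _)).comp
        (measurable_const_add μ)
    have hsplit : ∫⁻ ξ, stepValue σ' γ G good U s (μ + ξ) ∂(isotropicGaussian ι σ)
        = ∫⁻ ξ in gaussianBall ι σ, stepValue σ' γ G good U s (μ + ξ) ∂(isotropicGaussian ι σ)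
          + ∫⁻ ξ in (gaussianBall ι σ)ᶜ, stepValue σ' γ G good U s (μ + ξ)
            ∂(isotropicGaussian ι σ) :=
      (lintegral_add_compl _ (measurableSet_gaussianBall σ)).symm
    rw [hsplit]
    gcongr
    · unfold stepValue
      rw [lintegral_const_mul _ (Finset.measurable_sum _ fun x _ => hterm x),
        lintegral_finsetSum _ fun x _ => hterm x]
      refine mul_le_mul' le_rfl (Finset.sum_le_sum fun x _ => ?_)
      rw [hαint]
      have : ∀ ξ, (good x (parity s x)).indicator
          (fun w => ∫⁻ δ, U s (w - γ • G x (parity s x) w + δ) ∂(isotropicGaussian ι σ')) (μ + ξ)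
          = {ξ | μ + ξ ∈ good x (parity s x)}.indicator
            (fun ξ => u s (f x (parity s x) ξ)) ξ := by
        intro ξ
        by_cases hξ : μ + ξ ∈ good x (parity s x)
        · rw [Set.indicator_of_mem hξ, Set.indicator_of_mem (show ξ ∈ {ξ | μ + ξ ∈ good x (parity s x)} from hξ)]
          simp only [hu, hf, add_sub_assoc]
        · rw [Set.indicator_of_notMem hξ,
            Set.indicator_of_notMem (show ξ ∉ {ξ | μ + ξ ∈ good x (parity s x)} from hξ)]
      simp_rw [this]
      rw [lintegral_indicator (hRm x _), Measure.restrict_restrict (hRm x _), Set.inter_comm]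
    · calc _ ≤ ∫⁻ _ξ in (gaussianBall ι σ)ᶜ, 1 ∂(isotropicGaussian ι σ) :=
            lintegral_mono fun ξ => stepValue_le_one hU1 s _
        _ = t := by simp [t]
  have hrand' : ∑ s, ∑ x, ∑ y, 2⁻¹ * ∫⁻ z, u s z ∂(α x y) ≤ N * (C₂ * (N * V)) := by
    rw [Finset.sum_comm, ← hcard]
    refine Finset.sum_le_sum fun x _ => ?_
    rw [Finset.sum_comm]
    simp_rw [← Finset.mul_sum]
    rw [Fintype.sum_bool]
    calc _ ≤ 2⁻¹ * (C₂ * (N * V) + C₂ * (N * V)) := by gcongr <;> exact hrand x _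
      _ = C₂ * (N * V) := by
        rw [← two_mul, ← mul_assoc, ENNReal.inv_mul_cancel (by simp) (by simp), one_mul]
  -- One factor 2⁻ⁿ averages over the hidden set and the other over the training input.
  have hlast : N⁻¹ * (N⁻¹ * ENNReal.ofReal (2 ^ n * √(2 ^ n) * (C₁ / 2)))
      = ENNReal.ofReal (C₁ / (2 * √(2 ^ n))) := by
    have hNr : N = ENNReal.ofReal (2 ^ n) := by
      rw [hN, ENNReal.ofReal_pow (by norm_num)]; norm_num
    have hpos : (0 : ℝ) < 2 ^ n := by positivity
    rw [hNr, ← ENNReal.ofReal_inv_of_pos hpos, ← ENNReal.ofReal_mul (by positivity),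
      ← ENNReal.ofReal_mul (by positivity)]
    congr 1
    have hs : √((2 : ℝ) ^ n) ^ 2 = 2 ^ n := Real.sq_sqrt hpos.le
    have hs0 : √((2 : ℝ) ^ n) ≠ 0 := by positivity
    field_simp
    linear_combination (C₁ : ℝ) * hs
  calc _ ≤ N⁻¹ * ∑ s, (N⁻¹ * ∑ x, ∫⁻ z, u s z ∂(α x (parity s x)) + t) := by
        gcongr with s
        exact hreal s
    _ = N⁻¹ * (N⁻¹ * ∑ s, ∑ x, ∫⁻ z, u s z ∂(α x (parity s x))) + t := by
        rw [Finset.sum_add_distrib, hcard', mul_add, ← mul_assoc N⁻¹ N,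
          ENNReal.inv_mul_cancel hN0 hNt, one_mul, ← Finset.mul_sum]
    _ ≤ N⁻¹ * (N⁻¹ * (N * (C₂ * (N * V)) + ENNReal.ofReal (2 ^ n * √(2 ^ n) * (C₁ / 2)))) + t := by
        gcongr
        exact hkey.trans (by gcongr)
    _ = _ := by
        rw [mul_add, mul_add, hlast, ← mul_assoc N⁻¹ N, ENNReal.inv_mul_cancel hN0 hNt, one_mul,
          mul_left_comm, ← mul_assoc N⁻¹ N, ENNReal.inv_mul_cancel hN0 hNt, one_mul]
        ring

end AveragedStep

/-! ### Partial derivatives of smooth functions -/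

section PartialDeriv

variable {ι : Type*} [Fintype ι] [DecidableEq ι]

theorem partialDeriv_eq_fderiv {g : (ι → ℝ) → ℝ} (hg : Differentiable ℝ g) (e : ι) :
    partialDeriv e g = fun w => fderiv ℝ g w (Pi.single e 1) :=
  funext fun w => (hg w).lineDeriv_eq_fderiv

theorem contDiff_partialDeriv {g : (ι → ℝ) → ℝ} {k l : ℕ} (hkl : k + 1 = l)
    (hg : ContDiff ℝ l g) (e : ι) : ContDiff ℝ k (partialDeriv e g) := by
  subst hkl
  rw [partialDeriv_eq_fderiv (hg.differentiable (by simp))]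
  exact (hg.fderiv_right (m := (k : WithTop ℕ∞)) (by push_cast; exact le_rfl)).clm_apply
    contDiff_const

theorem isOpen_hasLargeDeriv (B : ℝ) {g : (ι → ℝ) → ℝ} (hg : ContDiff ℝ 3 g) :
    IsOpen {w | HasLargeDeriv B g w} := by
  have h1 : ∀ e, ContDiff ℝ (2 : ℕ) (partialDeriv e g) :=
    contDiff_partialDeriv (l := 3) rfl (by exact_mod_cast hg)
  have h2 : ∀ e₁ e₂, ContDiff ℝ (1 : ℕ) (partialDeriv e₁ (partialDeriv e₂ g)) := fun e₁ e₂ =>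
    contDiff_partialDeriv rfl (h1 e₂) e₁
  have h3 : ∀ e₁ e₂ e₃, ContDiff ℝ (0 : ℕ)
      (partialDeriv e₁ (partialDeriv e₂ (partialDeriv e₃ g))) := fun e₁ e₂ e₃ =>
    contDiff_partialDeriv rfl (h2 e₂ e₃) e₁
  have ho : ∀ {f : (ι → ℝ) → ℝ}, Continuous f → IsOpen {w | B < |f w|} := fun hf =>
    isOpen_lt continuous_const hf.abs
  have : {w | HasLargeDeriv B g w} = (⋃ e, {w | B < |partialDeriv e g w|}) ∪
      ((⋃ e₁, ⋃ e₂, {w | B < |partialDeriv e₁ (partialDeriv e₂ g) w|}) ∪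
      (⋃ e₁, ⋃ e₂, ⋃ e₃,
        {w | B < |partialDeriv e₁ (partialDeriv e₂ (partialDeriv e₃ g)) w|})) := by
    ext w
    simp [HasLargeDeriv]
  rw [this]
  exact (isOpen_iUnion fun e => ho (h1 e).continuous).union
    ((isOpen_iUnion fun e₁ => isOpen_iUnion fun e₂ => ho (h2 e₁ e₂).continuous).union
      (isOpen_iUnion fun e₁ => isOpen_iUnion fun e₂ => isOpen_iUnion fun e₃ =>
        ho (h3 e₁ e₂ e₃).continuous))

/-- The points such that no point within `τ` of them in each coordinate has a large derivative. -/
def tameSet (B τ : ℝ) (g : (ι → ℝ) → ℝ) : Set (ι → ℝ) :=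
  {w | ∀ w' : ι → ℝ, (∀ e, |w' e - w e| ≤ τ) → ¬ HasLargeDeriv B g w'}

/-- The complement is an uncountable union of translates of the set of large derivatives; it is
measurable because that set is open. -/
theorem measurableSet_tameSet (B τ : ℝ) {g : (ι → ℝ) → ℝ} (hg : ContDiff ℝ 3 g) :
    MeasurableSet (tameSet B τ g) := by
  have h : (tameSet B τ g)ᶜ
      = ⋃ d ∈ {d : ι → ℝ | ∀ e, |d e| ≤ τ}, (fun w => w + d) ⁻¹' {w | HasLargeDeriv B g w} := by
    ext w
    simp only [tameSet, Set.mem_compl_iff, Set.mem_ofPred_eq, not_forall, not_not, Set.mem_iUnion,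
      Set.mem_preimage, exists_prop]
    constructor
    · rintro ⟨w', hw', hB⟩
      exact ⟨w' - w, hw', by simpa using hB⟩
    · rintro ⟨d, hd, hB⟩
      exact ⟨w + d, by simpa using hd, hB⟩
  rw [← MeasurableSet.compl_iff, h]
  exact (isOpen_biUnion fun d _ =>
    (isOpen_hasLargeDeriv B hg).preimage (continuous_add_const d)).measurableSet

/-- Two points of the ball differ by at most twice its radius, hence by at most τ, in each
coordinate. So one tame point of μ + ball bounds all derivatives on μ + ball, and the third
derivatives make the Jacobian vary by at most B times the ℓ¹ radius. -/
theorem exists_controlledField {σ : NNReal} {B τ : ℝ} {g : (ι → ℝ) → ℝ} (hg : ContDiff ℝ 3 g)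
    (hτ : 2 * gaussianRadius ι σ ≤ τ) {μ : ι → ℝ}
    (h : ∃ ξ ∈ gaussianBall ι σ, μ + ξ ∈ tameSet B τ g) :
    ∃ H, ControlledField σ B (B * gaussianRadius ι σ)
      (fun ξ e => partialDeriv e g (μ + ξ)) H := by
  obtain ⟨ξ₀, hξ₀, htame⟩ := h
  have h1 : ∀ e, ContDiff ℝ (2 : ℕ) (partialDeriv e g) :=
    contDiff_partialDeriv (l := 3) rfl (by exact_mod_cast hg)
  have h2 : ∀ e₁ e₂, ContDiff ℝ (1 : ℕ) (partialDeriv e₁ (partialDeriv e₂ g)) := fun e₁ e₂ =>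
    contDiff_partialDeriv rfl (h1 e₂) e₁
  have hd1 : ∀ e, Differentiable ℝ (partialDeriv e g) := fun e => (h1 e).differentiable (by simp)
  have hd2 : ∀ e₁ e₂, Differentiable ℝ (partialDeriv e₁ (partialDeriv e₂ g)) := fun e₁ e₂ =>
    (h2 e₁ e₂).differentiable (by simp)
  have hsmall : ∀ ξ ∈ gaussianBall ι σ, ¬ HasLargeDeriv B g (μ + ξ) := by
    intro ξ hξ
    refine htame _ fun e => ?_
    have he : (μ + ξ) e - (μ + ξ₀) e = ξ e - ξ₀ e := by simp
    rw [he]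
    have := abs_sub (ξ e) (ξ₀ e)
    linarith [abs_apply_le_gaussianRadius hξ e, abs_apply_le_gaussianRadius hξ₀ e]
  simp only [HasLargeDeriv, not_or, not_exists, not_lt] at hsmall
  have hshift : ∀ {f : (ι → ℝ) → ℝ}, Differentiable ℝ f → ∀ ξ : ι → ℝ,
      HasFDerivAt (fun ξ => f (μ + ξ)) (fderiv ℝ f (μ + ξ)) ξ := by
    intro f hf ξ
    have := (hf (μ + ξ)).hasFDerivAt.comp ξ ((hasFDerivAt_id ξ).const_add μ)
    rwa [ContinuousLinearMap.comp_id] at this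
  refine ⟨fun ξ => Matrix.of fun e j => partialDeriv j (partialDeriv e g) (μ + ξ), ?_, ?_, ?_, ?_, ?_⟩
  · exact measurable_pi_lambda _ fun e =>
      ((h1 e).continuous.comp (continuous_const_add μ)).measurable
  · intro ξ _
    refine hasFDerivAt_pi'.mpr fun e => ?_
    refine (hshift (hd1 e) ξ).congr_fderiv ?_
    refine ContinuousLinearMap.coe_injective (LinearMap.pi_ext' fun j => LinearMap.ext_ring ?_)
    simp [partialDeriv_eq_fderiv (hd1 e)]
  · intro ξ hξ e
    exact (hsmall ξ hξ).1 e
  · intro ξ hξ e j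
    exact (hsmall ξ hξ).2.1 j e
  · intro ξ hξ e j
    have hBK : 0 ≤ B := (abs_nonneg _).trans ((hsmall ξ hξ).1 e)
    have := abs_sub_le_of_abs_partial_le (convex_gaussianBall σ)
      (fun ξ _ => hshift (hd2 j e) ξ) (K := B) (fun ξ hξ i => ?_) (zero_mem_gaussianBall σ) hξ
    · refine this.trans ?_
      gcongr
      simpa using sum_abs_le_gaussianRadius hξ
    · have := (hsmall ξ hξ).2.2 i j e
      rwa [partialDeriv_eq_fderiv (hd2 j e)] at this

end PartialDeriv

/-! ### Smoothness and size of neural nets -/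

namespace NeuralNet

variable {n : ℕ} {V : Type*}

/-- Otherwise the path from the constant vertex to the output would end with an edge into a source.
-/
theorem input_ne_out (N : NeuralNet n V) (i : Fin n) : N.input i ≠ N.out := by
  intro h
  have hpath := N.path_to_out N.const (h ▸ (N.input_ne_const i).symm)
  obtain ⟨u, -, hu⟩ := Relation.TransGen.tail'_iff.mp hpath
  exact (N.source_iff N.out).mpr (Or.inr ⟨i, h.symm⟩) u hu

theorem const_ne_out (hn : 0 < n) (N : NeuralNet n V) : N.const ≠ N.out := by
  intro h
  have hpath := N.path_to_out (N.input ⟨0, hn⟩) (N.input_ne_out _)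
  obtain ⟨u, -, hu⟩ := Relation.TransGen.tail'_iff.mp hpath
  exact (N.source_iff N.out).mpr (Or.inl h.symm) u hu

theorem exists_edge_of_ne_out (N : NeuralNet n V) {v : V} (hv : v ≠ N.out) :
    ∃ u, (v, u) ∈ N.edges := by
  obtain ⟨u, hu, -⟩ := Relation.TransGen.head'_iff.mp (N.path_to_out v hv)
  exact ⟨u, hu⟩

/-- Each of the `n + 1` sources has an outgoing edge. -/
theorem succ_le_card_edges (hn : 0 < n) (N : NeuralNet n V) : n + 1 ≤ N.edges.card := by
  let src : Option (Fin n) → V := fun o => o.elim N.const N.input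
  have hsrc : ∀ o, src o ≠ N.out := fun o => by
    cases o with
    | none => exact N.const_ne_out hn
    | some i => exact N.input_ne_out i
  have hinj : Function.Injective src := by
    intro a b hab
    cases a <;> cases b
    · rfl
    · exact absurd hab.symm (N.input_ne_const _)
    · exact absurd hab (N.input_ne_const _)
    · exact congrArg some (N.input_injective hab)
  choose tgt htgt using fun o => N.exists_edge_of_ne_out (hsrc o)
  have := Finset.card_le_card_of_injOn (s := (Finset.univ : Finset (Option (Fin n))))
    (t := N.edges) (fun o => (src o, tgt o)) (fun o _ => htgt o)
    (fun a _ b _ hab => hinj (congrArg Prod.fst hab))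
  simpa using this

variable [Fintype V] [DecidableEq V]

open Classical in
theorem value_eq (N : NeuralNet n V) (w : N.edges → ℝ) (x : Fin n → ℝ) (v : V) :
    N.value w x v = if v = N.const then 1
      else if h : ∃ i, v = N.input i then x h.choose
      else N.act (∑ u : {u : V // (u, v) ∈ N.edges}, w ⟨(u.1, v), u.2⟩ * N.value w x u.1) := by
  rw [value, WellFounded.fix_eq]

theorem contDiff_value (N : NeuralNet n V) {k : WithTop ℕ∞} (hact : ContDiff ℝ k N.act)
    (x : Fin n → ℝ) (v : V) : ContDiff ℝ k fun w => N.value w x v := by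
  induction v using N.wellFounded_edge.induction with
  | _ v ih =>
    simp_rw [N.value_eq _ x v]
    split_ifs
    · exact contDiff_const
    · exact contDiff_const
    · exact hact.comp (ContDiff.sum fun u _ => (contDiff_apply ℝ ℝ _).mul (ih u.1 u.2))

theorem contDiff_loss (N : NeuralNet n V) {k : WithTop ℕ∞} (hact : ContDiff ℝ k N.act)
    {L : ℝ → ℝ} (hL : ContDiff ℝ k L) (enc : Bool → ℝ) (x : Fin n → Bool) (y : Bool) :
    ContDiff ℝ k (N.loss L enc x y) :=
  hL.comp ((N.contDiff_value hact _ _).sub contDiff_const)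

end NeuralNet

/-! ### Iterating the averaged step -/

section Iterate

variable {ι : Type*} [Fintype ι] {n : ℕ}

theorem iterate_stepValue_le_one {σ' : NNReal} {γ : ℝ}
    {G : (Fin n → Bool) → Bool → (ι → ℝ) → ι → ℝ}
    {good : (Fin n → Bool) → Bool → Set (ι → ℝ)} {U : Finset (Fin n) → (ι → ℝ) → ENNReal}
    (hU : ∀ s w, U s w ≤ 1) (k : ℕ) (s : Finset (Fin n)) (w : ι → ℝ) :
    (stepValue σ' γ G good)^[k] U s w ≤ 1 := by
  induction k generalizing s w with
  | zero => exact hU s w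
  | succ k ih =>
    rw [Function.iterate_succ_apply']
    exact stepValue_le_one ih s w

theorem measurable_iterate_stepValue {σ' : NNReal} {γ : ℝ}
    {G : (Fin n → Bool) → Bool → (ι → ℝ) → ι → ℝ} (hG : ∀ x y, Measurable (G x y))
    {good : (Fin n → Bool) → Bool → Set (ι → ℝ)} (hgood : ∀ x y, MeasurableSet (good x y))
    {U : Finset (Fin n) → (ι → ℝ) → ENNReal} (hU : ∀ s, Measurable (U s)) (k : ℕ)
    (s : Finset (Fin n)) : Measurable ((stepValue σ' γ G good)^[k] U s) := by
  induction k generalizing s with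
  | zero => exact hU s
  | succ k ih =>
    rw [Function.iterate_succ_apply']
    exact measurable_stepValue hG hgood ih s

variable [DecidableEq ι]

/-- Induction on the remaining steps, with the centre μ general because a step replaces one Gaussian
by a mixture with many centres. -/
theorem StepConstants.average_iterate_stepValue_le {σ σ' : NNReal} {B γ Λ : ℝ} {C₁ R : NNReal}
    (hc : StepConstants ι σ σ' B γ Λ C₁ (1 + R))
    {G : (Fin n → Bool) → Bool → (ι → ℝ) → ι → ℝ} (hG : ∀ x y, Measurable (G x y))
    {good : (Fin n → Bool) → Bool → Set (ι → ℝ)} (hgood : ∀ x y, MeasurableSet (good x y))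
    (hctrl : ∀ (μ : ι → ℝ) x y, (∃ ξ ∈ gaussianBall ι σ, μ + ξ ∈ good x y) →
      ∃ H, ControlledField σ B Λ (fun ξ => G x y (μ + ξ)) H)
    {U : Finset (Fin n) → (ι → ℝ) → ENNReal} (hU : ∀ s, Measurable (U s)) (hU1 : ∀ s w, U s w ≤ 1)
    {V : ENNReal} (hV : ∀ w : ι → ℝ, (2 ^ n)⁻¹ * ∑ s, U s w ≤ V) (k : ℕ) (μ : ι → ℝ) :
    (2 ^ n)⁻¹ * ∑ s, ∫⁻ ξ, (stepValue σ' γ G good)^[k] U s (μ + ξ) ∂(isotropicGaussian ι σ)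
      ≤ V + k * (R + isotropicGaussian ι σ (gaussianBall ι σ)ᶜ
        + ENNReal.ofReal (C₁ / (2 * √(2 ^ n)))) := by
  set η := R + isotropicGaussian ι σ (gaussianBall ι σ)ᶜ + ENNReal.ofReal (C₁ / (2 * √(2 ^ n)))
  induction k generalizing μ with
  | zero =>
    simp only [Function.iterate_zero, id_eq, Nat.cast_zero, zero_mul, add_zero]
    have hm : ∀ s, Measurable fun ξ => U s (μ + ξ) := fun s =>
      (hU s).comp (measurable_const_add μ)
    rw [← lintegral_finsetSum _ fun s _ => hm s,
      ← lintegral_const_mul _ (Finset.measurable_sum _ fun s _ => hm s)]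
    calc _ ≤ ∫⁻ _ξ, V ∂(isotropicGaussian ι σ) := lintegral_mono fun ξ => hV _
      _ = V := by simp
  | succ k ih =>
    -- Feeding the minimum with 1 into the one-step bound turns the factor 1 + R into an additive R,
    -- so errors grow linearly in k.
    have hle1 : ∀ ν : ι → ℝ, (2 ^ n)⁻¹ * ∑ s,
        ∫⁻ ξ, (stepValue σ' γ G good)^[k] U s (ν + ξ) ∂(isotropicGaussian ι σ) ≤ 1 := by
      intro ν
      calc _ ≤ (2 ^ n : ENNReal)⁻¹ * ∑ _s : Finset (Fin n), 1 := by
            gcongr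
            exact lintegral_le_one_of_le_one fun _ => iterate_stepValue_le_one hU1 k _ _
        _ = 1 := by
            simp
            exact ENNReal.inv_mul_cancel (by simp) (by simp)
    have := hc.average_stepValue_le hG hgood hctrl
      (fun s => measurable_iterate_stepValue (σ' := σ') (γ := γ) hG hgood hU k s)
      (fun s w => iterate_stepValue_le_one hU1 k s w) (V := min (V + k * η) 1)
      (fun ν => le_min (ih ν) (hle1 ν)) μ
    simp_rw [Function.iterate_succ_apply']
    refine this.trans ?_
    push_cast
    calc (1 + (R : ENNReal)) * min (V + k * η) 1 + isotropicGaussian ι σ (gaussianBall ι σ)ᶜ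
          + ENNReal.ofReal (C₁ / (2 * √(2 ^ n)))
        = min (V + k * η) 1 + (R * min (V + k * η) 1
          + isotropicGaussian ι σ (gaussianBall ι σ)ᶜ
          + ENNReal.ofReal (C₁ / (2 * √(2 ^ n)))) := by ring
      _ ≤ (V + k * η) + (R * 1 + isotropicGaussian ι σ (gaussianBall ι σ)ᶜ
          + ENNReal.ofReal (C₁ / (2 * √(2 ^ n)))) := by
          gcongr
          · exact min_le_left _ _
          · exact min_le_right _ _
      _ = V + (k + 1) * η := by rw [mul_one]; ring

end Iterate

/-! ### Integrals over independent samples -/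

theorem lintegral_pi_fin_succ {α : Type*} [MeasurableSpace α] (ν : Measure α) [SigmaFinite ν]
    {k : ℕ} {F : α → (Fin k → α) → ENNReal} (hF : Measurable (Function.uncurry F)) :
    ∫⁻ f, F (f 0) (Fin.tail f) ∂(Measure.pi fun _ : Fin (k + 1) => ν)
      = ∫⁻ a, ∫⁻ b, F a b ∂(Measure.pi fun _ : Fin k => ν) ∂ν := by
  have hmp := measurePreserving_piFinSuccAbove (fun _ : Fin (k + 1) => ν) 0
  have h := hmp.lintegral_comp hF
  rw [lintegral_prod _ hF.aemeasurable] at h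
  exact h

theorem lintegral_uniformOn_univ {α : Type*} [Fintype α] [MeasurableSpace α]
    [MeasurableSingletonClass α] (f : α → ENNReal) :
    ∫⁻ a, f a ∂(uniformOn (Set.univ : Set α)) = (Fintype.card α : ENNReal)⁻¹ * ∑ a, f a := by
  rw [lintegral_fintype, Finset.mul_sum]
  refine Finset.sum_congr rfl fun a _ => ?_
  rw [uniformOn_univ, Measure.count_singleton, one_div, mul_comm]

/-- Needed to write integrals over the hidden set as finite sums. -/
instance {α : Type*} [Finite α] : MeasurableSingletonClass (Finset α) := by
  refine ⟨fun s => ?_⟩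
  have : ({s} : Set (Finset α)) = ⋂ a, {t | a ∈ t ↔ a ∈ s} := by
    ext t
    simp [Finset.ext_iff]
  rw [this]
  refine MeasurableSet.iInter fun a => ?_
  by_cases ha : a ∈ s
  · simpa [ha] using measurableSet_setOfPred.mpr (measurable_finset_mem a)
  · have h : {t : Finset α | a ∈ t ↔ a ∈ s} = {t | a ∈ t}ᶜ := by
      ext t
      simp [ha]
    rw [h]
    exact (measurableSet_setOfPred.mpr (measurable_finset_mem a)).compl

/-! ### Unrolling the training -/

section PathValue

variable {ι : Type*} {n : ℕ}

/-- The reward `U` at the end of a noisy gradient descent which uses the gradient `G (X i)` and the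
noise `δ i` in the step `i`, and `0` if the weights in some step are outside `good (X i)`. -/
noncomputable def pathValue (γ : ℝ) (G : (Fin n → Bool) → (ι → ℝ) → ι → ℝ)
    (good : (Fin n → Bool) → Set (ι → ℝ)) (U : (ι → ℝ) → ENNReal) :
    (k : ℕ) → (Fin k → Fin n → Bool) → (ι → ℝ) → (Fin k → ι → ℝ) → ENNReal
  | 0, _, w, _ => U w
  | k + 1, X, w, δ => (good (X 0)).indicator
      (fun w => pathValue γ G good U k (Fin.tail X) (w - γ • G (X 0) w + δ 0) (Fin.tail δ)) w

variable {γ : ℝ} {G : (Fin n → Bool) → (ι → ℝ) → ι → ℝ} {good : (Fin n → Bool) → Set (ι → ℝ)}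
  {U : (ι → ℝ) → ENNReal}

theorem measurable_pathValue (hG : ∀ x, Measurable (G x)) (hgood : ∀ x, MeasurableSet (good x))
    (hU : Measurable U) (k : ℕ) (X : Fin k → Fin n → Bool) :
    Measurable fun p : (ι → ℝ) × (Fin k → ι → ℝ) => pathValue γ G good U k X p.1 p.2 := by
  induction k with
  | zero => exact hU.comp measurable_fst
  | succ k ih =>
    have hinner : Measurable fun p : (ι → ℝ) × (Fin (k + 1) → ι → ℝ) =>
        pathValue γ G good U k (Fin.tail X) (p.1 - γ • G (X 0) p.1 + p.2 0) (Fin.tail p.2) := by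
      have hGX := hG (X 0)
      refine (ih (Fin.tail X)).comp (Measurable.prodMk (by fun_prop) ?_)
      exact measurable_pi_lambda _ fun i => (measurable_pi_apply i.succ).comp measurable_snd
    have hset : MeasurableSet {p : (ι → ℝ) × (Fin (k + 1) → ι → ℝ) | p.1 ∈ good (X 0)} :=
      measurable_fst (hgood (X 0))
    refine (congrArg Measurable (funext fun p => ?_)).mpr (hinner.indicator hset)
    simp only [pathValue]
    by_cases hp : p.1 ∈ good (X 0)
    · rw [Set.indicator_of_mem hp,
        Set.indicator_of_mem (show p ∈ {p : (ι → ℝ) × (Fin (k + 1) → ι → ℝ) | p.1 ∈ good (X 0)} from hp)]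
    · rw [Set.indicator_of_notMem hp,
        Set.indicator_of_notMem (show p ∉ {p : (ι → ℝ) × (Fin (k + 1) → ι → ℝ) | p.1 ∈ good (X 0)} from hp)]

variable [Fintype ι]

/-- The expected reward at the end of the training is an iterate of `stepValue`. -/
theorem lintegral_pathValue {σ' : NNReal} {G : (Fin n → Bool) → Bool → (ι → ℝ) → ι → ℝ}
    (hG : ∀ x y, Measurable (G x y)) {good : (Fin n → Bool) → Bool → Set (ι → ℝ)}
    (hgood : ∀ x y, MeasurableSet (good x y)) {U : Finset (Fin n) → (ι → ℝ) → ENNReal}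
    (hU : ∀ s, Measurable (U s)) (s : Finset (Fin n)) (k : ℕ) (w : ι → ℝ) :
    ∫⁻ X, ∫⁻ δ, pathValue γ (fun x => G x (parity s x)) (fun x => good x (parity s x)) (U s) k X w δ
        ∂(Measure.pi fun _ : Fin k => isotropicGaussian ι σ')
        ∂(Measure.pi fun _ : Fin k => uniformOn (Set.univ : Set (Fin n → Bool)))
      = (stepValue σ' γ G good)^[k] U s w := by
  induction k generalizing w with
  | zero => simp [pathValue]
  | succ k ih =>
    set P := pathValue γ (fun x => G x (parity s x)) (fun x => good x (parity s x)) (U s) with hP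
    have hPm : ∀ k X, Measurable fun p : (ι → ℝ) × (Fin k → ι → ℝ) => P k X p.1 p.2 := fun k X =>
      measurable_pathValue (fun x => hG x _) (fun x => hgood x _) (hU s) k X
    have h1 : ∀ X : Fin (k + 1) → Fin n → Bool,
        ∫⁻ δ, P (k + 1) X w δ ∂(Measure.pi fun _ : Fin (k + 1) => isotropicGaussian ι σ')
          = (good (X 0) (parity s (X 0))).indicator (fun w => ∫⁻ δ₀, ∫⁻ δ,
            P k (Fin.tail X) (w - γ • G (X 0) (parity s (X 0)) w + δ₀) δ
            ∂(Measure.pi fun _ : Fin k => isotropicGaussian ι σ') ∂(isotropicGaussian ι σ')) w := by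
      intro X
      by_cases hw : w ∈ good (X 0) (parity s (X 0))
      · rw [Set.indicator_of_mem hw, ← lintegral_pi_fin_succ]
        · refine lintegral_congr fun δ => ?_
          simp only [hP, pathValue]
          rw [Set.indicator_of_mem hw]
        · exact (hPm k (Fin.tail X)).comp
            (Measurable.prodMk (by fun_prop) measurable_snd)
      · rw [Set.indicator_of_notMem hw]
        have : ∀ δ, P (k + 1) X w δ = 0 := fun δ => by
          simp only [hP, pathValue]
          rw [Set.indicator_of_notMem hw]
        simp [this]
    simp_rw [h1]
    rw [lintegral_pi_fin_succ (uniformOn (Set.univ : Set (Fin n → Bool)))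
      (F := fun x X => (good x (parity s x)).indicator (fun w => ∫⁻ δ₀, ∫⁻ δ,
            P k X (w - γ • G x (parity s x) w + δ₀) δ
            ∂(Measure.pi fun _ : Fin k => isotropicGaussian ι σ') ∂(isotropicGaussian ι σ')) w)
      (measurable_of_countable _), lintegral_uniformOn_univ, Function.iterate_succ_apply',
      stepValue]
    congr 1
    · simp
    refine Finset.sum_congr rfl fun x _ => ?_
    by_cases hw : w ∈ good x (parity s x)
    · simp_rw [Set.indicator_of_mem hw]
      -- The first noise is integrated last, so that the induction hypothesis applies at the updated
      -- weights.
      rw [lintegral_lintegral_swap]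
      · exact lintegral_congr fun δ₀ => ih _
      · refine (measurable_from_prod_countable_right fun X => ?_).aemeasurable
        refine Measurable.lintegral_prod_right' (f := fun p : (ι → ℝ) × (Fin k → ι → ℝ) =>
          P k X (w - γ • G x (parity s x) w + p.1) p.2) ?_
        exact (hPm k X).comp (Measurable.prodMk (by fun_prop) measurable_snd)
    · simp_rw [Set.indicator_of_notMem hw]
      simp

end PathValue

/-! ### Numerical estimates -/

section Numerics

/-- The m-th power of exp(-y/(1-y)) ≤ 1 - y, which is 1 + t ≤ exp t at t = y/(1-y). -/
theorem exp_neg_le_one_sub_pow {y : ℝ} (hy : y < 1) (m : ℕ) :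
    Real.exp (-(m * y / (1 - y))) ≤ (1 - y) ^ m := by
  have h1 : 0 < 1 - y := by linarith
  have h2 : Real.exp (-(y / (1 - y))) ≤ 1 - y := by
    rw [Real.exp_neg, inv_le_comm₀ (Real.exp_pos _) h1]
    have := Real.add_one_le_exp (y / (1 - y))
    have h3 : y / (1 - y) + 1 = (1 - y)⁻¹ := by field_simp; ring
    linarith
  calc Real.exp (-(m * y / (1 - y))) = Real.exp (-(y / (1 - y))) ^ m := by
        rw [← Real.exp_nat_mul]; congr 1; ring
    _ ≤ (1 - y) ^ m := by gcongr

theorem sqrt_one_add_pow_le_exp {ε : ℝ} (m : ℕ) :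
    √(1 + ε) ^ m ≤ Real.exp (m * (ε / 2)) := by
  have : √(1 + ε) ≤ Real.exp (ε / 2) := by
    rw [Real.exp_half]
    exact Real.sqrt_le_sqrt (by linarith [Real.add_one_le_exp ε])
  rw [Real.exp_nat_mul]
  gcongr

/-- An exponential factor absorbed by a multiple of a determinant bound. -/
theorem exp_le_one_add_mul_one_sub_pow {m : ℕ} (hm : 2 ≤ m) {θ R : ℝ} (hθ : 0 ≤ θ)
    (hR : 4.87 * (m * θ) ≤ R) (hR' : R ≤ 1 / 2) :
    Real.exp (2 * m * θ + m * θ ^ 2) ≤ (1 + R) * (1 - θ) ^ m := by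
  have hm' : (2 : ℝ) ≤ m := by exact_mod_cast hm
  set x : ℝ := m * θ with hx
  have hx0 : 0 ≤ x := by positivity
  have hx1 : x ≤ 0.103 := by linarith
  have hθx : θ ≤ x / 2 := by nlinarith
  have hθ1 : 0 < 1 - θ := by linarith
  have hpow := exp_neg_le_one_sub_pow (y := θ) (by linarith) m
  have hdiv : x / (1 - θ) ≤ 1.056 * x := by
    rw [div_le_iff₀ hθ1]
    nlinarith
  have hy : 2 * x + x * θ + x / (1 - θ) ≤ 3.15 * x := by nlinarith
  have hexp : Real.exp (2 * x + x * θ + x / (1 - θ)) ≤ 1 + R := by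
    set y := 2 * x + x * θ + x / (1 - θ)
    -- Here exp y ≤ 1/(1-y), y ≤ 3.15 x, and (1 + 4.87 x)(1 - 3.15 x) ≥ 1 for 0 ≤ x ≤ 0.103.
    have hy1 : 0 < 1 - y := by linarith
    have h1 : Real.exp y ≤ (1 - y)⁻¹ := by
      rw [← inv_inv (Real.exp y), ← Real.exp_neg]
      exact inv_anti₀ hy1 (by linarith [Real.add_one_le_exp (-y)])
    refine h1.trans (inv_le_of_inv_le₀ (by linarith) ?_)
    rw [inv_le_iff_one_le_mul₀ (by linarith)]
    nlinarith
  calc Real.exp (2 * m * θ + m * θ ^ 2)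
      = Real.exp (2 * x + x * θ + x / (1 - θ)) * Real.exp (-(m * θ / (1 - θ))) := by
        rw [← Real.exp_add, ← hx]; congr 1; rw [hx]; ring
    _ ≤ (1 + R) * (1 - θ) ^ m := by
        gcongr
        linarith

-- Everything is expressed through q = mγB, at most π/80 because n < m, and √(2σ) = 40q/(n√π). The
-- given σ is large enough for the label estimate, where the shift γB is compared with √σ, and small
-- enough for the step to be nearly linear on the ball.
set_option maxHeartbeats 1000000 in
theorem stepConstants_of_rate_le {ι : Type*} [Fintype ι] {n : ℕ} (hn : 0 < n)
    (hm : n + 1 ≤ Fintype.card ι) {B γ : ℝ} (hB : 0 < B) (hγ : 0 < γ)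
    (hγ' : γ ≤ Real.pi * n / (80 * Fintype.card ι ^ 2 * B)) {σ σ' : NNReal}
    (hσ : (σ : ℝ) = (40 * Fintype.card ι * γ * B / n) ^ 2 / (2 * Real.pi))
    (hσ' : (σ' : ℝ) = (2 * Fintype.card ι * B * γ - Fintype.card ι ^ 2 * B ^ 2 * γ ^ 2) * σ)
    {R : NNReal} (hR : (R : ℝ) = 360 * Fintype.card ι ^ 4 * B ^ 2 * γ ^ 2 / (Real.pi * n))
    (hR' : (R : ℝ) ≤ 1 / 2) {C₁ : NNReal} (hC₁ : (C₁ : ℝ) = Real.exp (n / 4)) :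
    StepConstants ι σ σ' B γ (B * gaussianRadius ι σ) C₁ (1 + R) ∧
      2 * gaussianRadius ι σ ≤ 160 * Fintype.card ι ^ 2 * γ * B / (Real.pi * n) := by
  set m := Fintype.card ι with hmdef
  have hn0 : (0 : ℝ) < n := by exact_mod_cast hn
  have hm1 : (n : ℝ) + 1 ≤ m := by exact_mod_cast hm
  have hm0 : (0 : ℝ) < m := by linarith
  have hπ := Real.pi_pos
  have hπ1 := Real.pi_lt_d4
  set q : ℝ := m * (γ * B) with hq
  have hq0 : 0 < q := by positivity
  have hmq : m * q ≤ Real.pi * n / 80 := by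
    rw [le_div_iff₀ (by positivity)] at hγ' ⊢
    rw [hq]
    linarith
  have hmq' : m * q ≤ 0.0393 * n := by nlinarith
  have hq1 : q ≤ 0.0393 := by
    have : m * q ≤ 0.0393 * m := by nlinarith
    by_contra hcon
    push Not at hcon
    nlinarith
  have h1q : 0 < 1 - q := by linarith
  have h1q' : 1 - q ≠ 0 := h1q.ne'
  set w := √Real.pi with hw
  have hw0 : 0 < w := Real.sqrt_pos.mpr hπ
  have hw2 : w ^ 2 = Real.pi := Real.sq_sqrt hπ.le
  have hw1 : w ≤ 1.775 := by
    rw [hw, Real.sqrt_le_left (by norm_num)]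
    linarith
  have hr : √(2 * (σ : ℝ)) = 40 * q / (n * w) := by
    rw [hσ, Real.sqrt_eq_iff_mul_self_eq (by positivity) (by positivity), ← hw2, hq]
    field_simp
  have hρ : gaussianRadius ι σ = m * (40 * q / (n * w)) := by rw [gaussianRadius, hr]
  have hσw : (σ : ℝ) = (40 * q / (n * w)) ^ 2 / 2 := by
    rw [← hr, Real.sq_sqrt (by positivity)]; ring
  have hσ0 : (0 : ℝ) < σ := by rw [hσw]; positivity
  set θ : ℝ := q * (m * (40 * q / (n * w))) / (1 - q) with hθ
  have hθ0 : 0 ≤ θ := by positivity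
  -- Exactly R = (9(1-q)/√π) mθ; the constant comes from q ≤ 0.0393 and √π ≤ 1.775.
  have hRθ : 4.87 * (m * θ) ≤ R := by
    have h1 : (R : ℝ) = 9 * (1 - q) / w * (m * θ) := by
      have h2 : (R : ℝ) = 360 * m ^ 2 * q ^ 2 / (w ^ 2 * n) := by
        rw [hR, hw2, hq]
        ring
      rw [h2, hθ]
      field_simp
      norm_num
    rw [h1]
    gcongr
    rw [le_div_iff₀ hw0]
    linarith
  have hm2 : 2 ≤ m := by omega
  refine ⟨⟨NNReal.coe_ne_zero.mp hσ0.ne', hγ.le, hB.le, ?_, by linarith, ?_, ?_, ?_⟩, ?_⟩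
  · rw [hρ]; positivity
  · rw [hσ', ← hmdef]; ring
  -- With ε = n/(4m) the exponents are n/8 from the variance, πn/400 from the shift and at most n/20
  -- from the determinant; their sum is below n/4.
  · obtain ⟨ε, hε⟩ : ∃ ε : NNReal, (ε : ℝ) = n / (4 * m) := ⟨⟨_, by positivity⟩, rfl⟩
    refine ⟨ε, NNReal.coe_ne_zero.mp (by rw [hε]; positivity), ?_⟩
    · rw [hε, ← hmdef, ← hq]
      have h1 : m * (γ * B) ^ 2 / (2 * (n / (4 * m)) * σ) = Real.pi * n / 400 := by
        rw [hσw, hq, ← hw2]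
        field_simp
        norm_num
      have h2 : (m : ℝ) * ((n : ℝ) / (4 * m) / 2) = n / 8 := by field_simp; norm_num
      have h3 : (m : ℝ) * q / (1 - q) ≤ n / 20 := by
        rw [div_le_iff₀ h1q]
        nlinarith
      calc √(1 + n / (4 * m)) ^ m * Real.exp (m * (γ * B) ^ 2 / (2 * (n / (4 * m)) * σ))
          ≤ Real.exp (n / 8) * Real.exp (Real.pi * n / 400) := by
            rw [h1, ← h2]
            gcongr
            exact sqrt_one_add_pow_le_exp m
        _ ≤ Real.exp (n / 4) * Real.exp (-(m * q / (1 - q))) := by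
            rw [← Real.exp_add, ← Real.exp_add]
            refine Real.exp_le_exp.mpr ?_
            have h4 : Real.pi * n ≤ 3.1416 * n := mul_le_mul_of_nonneg_right hπ1.le hn0.le
            linarith
        _ ≤ C₁ * (1 - q) ^ m := by
            rw [hC₁]
            exact mul_le_mul_of_nonneg_left (exp_neg_le_one_sub_pow (by linarith) m)
              (Real.exp_pos _).le
  · have hx1 : m * θ ≤ 0.103 := by linarith
    have hθ1 : θ < 1 := by nlinarith
    refine ⟨θ * (40 * q / (n * w)), θ, ?_, ?_, hθ1, ?_⟩
    · rw [hρ, ← hmdef, ← hq, hθ, show γ * (B * (m * (40 * q / (n * w)))) = q * (40 * q / (n * w)) by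
        rw [hq]; ring]
      field_simp
    · rw [hρ, ← hmdef, ← hq, hθ]
      rw [show (m : ℝ) * (γ * (B * (m * (40 * q / (n * w))))) = q * (m * (40 * q / (n * w))) by
        rw [hq]; ring]
    · have := exp_le_one_add_mul_one_sub_pow hm2 hθ0 hRθ hR'
      push_cast
      convert this using 2
      rw [hρ, hσw, ← hmdef]
      field_simp
  · rw [hρ]
    -- The allowed distance τ is twice the ball's ℓ¹ radius times 2/√π, a factor above 1.
    have : 160 * (m : ℝ) ^ 2 * γ * B / (Real.pi * n) = 2 * (m * (40 * q / (n * w))) * (2 / w) := by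
      rw [← hw2, hq]
      field_simp
      ring
    rw [this]
    refine le_mul_of_one_le_right (by positivity) ?_
    rw [le_div_iff₀ hw0]
    linarith

theorem tail_le_rpow {n m : ℕ} (hnm : n ≤ m) :
    (2 * Real.exp (-1)) ^ ((m : ℝ) / 2) ≤ (Real.exp 1 / 4) ^ ((n : ℝ) / 4) := by
  have he : 0 < Real.exp (-1) := Real.exp_pos _
  have he1 := Real.exp_one_gt_d9
  have hinv : Real.exp (-1) * Real.exp 1 = 1 := by rw [← Real.exp_add]; norm_num
  have hle1 : 2 * Real.exp (-1) ≤ 1 := by nlinarith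
  have hnm' : (n : ℝ) ≤ m := by exact_mod_cast hnm
  calc (2 * Real.exp (-1)) ^ ((m : ℝ) / 2)
      ≤ (2 * Real.exp (-1)) ^ ((n : ℝ) / 2) :=
        Real.rpow_le_rpow_of_exponent_ge (by positivity) hle1 (by linarith)
    _ = ((2 * Real.exp (-1)) ^ 2) ^ ((n : ℝ) / 4) := by
        rw [← Real.rpow_natCast, ← Real.rpow_mul (by positivity)]
        congr 1
        push_cast; ring
    _ ≤ (Real.exp 1 / 4) ^ ((n : ℝ) / 4) := by
        refine Real.rpow_le_rpow (by positivity) ?_ (by positivity)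
        have h2 : Real.exp (-1) ≤ 0.368 := by nlinarith
        nlinarith

theorem two_rpow_neg_le_rpow (n : ℕ) :
    ((2 : ℝ) ^ n)⁻¹ ≤ (Real.exp 1 / 4) ^ ((n : ℝ) / 4) := by
  have he1 := Real.exp_one_gt_d9
  calc ((2 : ℝ) ^ n)⁻¹ = ((1 / 2 : ℝ) ^ 4) ^ ((n : ℝ) / 4) := by
        rw [← Real.rpow_natCast (1 / 2 : ℝ) 4, ← Real.rpow_mul (by positivity), one_div,
          Real.inv_rpow (by norm_num), ← Real.rpow_natCast]
        congr 2
        push_cast; ring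
    _ ≤ _ := by
        refine Real.rpow_le_rpow (by positivity) ?_ (by positivity)
        norm_num
        linarith

/-- Since √2ⁿ = 4^{n/4}, the factor e^{n/4} lost in the density bound is outweighed by the gain from
Parseval. -/
theorem exp_div_sqrt_two_pow (n : ℕ) :
    Real.exp (n / 4) / (2 * √(2 ^ n)) = (Real.exp 1 / 4) ^ ((n : ℝ) / 4) / 2 := by
  have h4 : (4 : ℝ) ^ ((n : ℝ) / 4) = √(2 ^ n) := by
    rw [Real.sqrt_eq_rpow, ← Real.rpow_natCast, ← Real.rpow_mul (by norm_num),
      show (4 : ℝ) = 2 ^ (2 : ℝ) by norm_num, ← Real.rpow_mul (by norm_num)]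
    congr 1
    ring
  rw [Real.div_rpow (by positivity) (by norm_num), h4, ← Real.exp_mul, one_mul]
  field_simp

end Numerics

/-! ### The experiment -/

namespace NeuralNet

variable {n : ℕ} {V : Type*} [Fintype V] [DecidableEq V]

/-- After the first step, training goes on from the new weights with the remaining samples. -/
theorem noisySGD_succ (N : NeuralNet n V) (L : ℝ → ℝ) (enc : Bool → ℝ) (γ : ℝ) {T : ℕ}
    {ξ ξ' : N.edges → ℝ} {X : Fin (T + 1) → Fin n → Bool} {Y : Fin (T + 1) → Bool}
    {δ : Fin (T + 1) → N.edges → ℝ}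
    (hξ' : ∀ e, N.weight e + ξ' e = N.weight e + ξ e
      - γ * partialDeriv e (N.loss L enc (X 0) (Y 0)) (fun e => N.weight e + ξ e) + δ 0 e)
    (i : ℕ) (hi : i + 1 ≤ T + 1) :
    N.noisySGD L enc γ ξ X Y δ (i + 1) hi
      = N.noisySGD L enc γ ξ' (Fin.tail X) (Fin.tail Y) (Fin.tail δ) i (Nat.le_of_succ_le_succ hi) := by
  induction i with
  | zero =>
    funext e
    exact (hξ' e).symm
  | succ i ih =>
    rw [noisySGD, ih, noisySGD]
    rfl

/-- Reconciles two recursions: `pathValue` peels off the first step, as the backward induction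
requires, while `noisySGD` peels off the last. -/
theorem pathValue_eq (N : NeuralNet n V) (L : ℝ → ℝ) (enc : Bool → ℝ) (γ : ℝ)
    (y : (Fin n → Bool) → Bool) (good : (Fin n → Bool) → Set (N.edges → ℝ))
    (U : (N.edges → ℝ) → ENNReal) {k : ℕ} (X : Fin k → Fin n → Bool) (ξ : N.edges → ℝ)
    (δ : Fin k → N.edges → ℝ) [Decidable (∀ i : Fin k,
      N.noisySGD L enc γ ξ X (fun j => y (X j)) δ i i.isLt.le ∈ good (X i))] :
    pathValue γ (fun x w e => partialDeriv e (N.loss L enc x (y x)) w) good U k X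
        (fun e => N.weight e + ξ e) δ
      = if ∀ i : Fin k, N.noisySGD L enc γ ξ X (fun j => y (X j)) δ i i.isLt.le ∈ good (X i)
        then U (N.noisySGD L enc γ ξ X (fun j => y (X j)) δ k le_rfl) else 0 := by
  classical
  induction k generalizing ξ with
  | zero => simp [pathValue, noisySGD]
  | succ k ih =>
    set w₁ : N.edges → ℝ := (fun e => N.weight e + ξ e)
      - γ • (fun e => partialDeriv e (N.loss L enc (X 0) (y (X 0))) fun e => N.weight e + ξ e)
      + δ 0 with hw₁
    have hξ' : w₁ = fun e => N.weight e + (w₁ e - N.weight e) := by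
      funext e
      ring
    -- Restarting from w₁ means perturbing the original weights by w₁ - `N.weight`.
    have hs := N.noisySGD_succ L enc γ (ξ := ξ) (ξ' := fun e => w₁ e - N.weight e) (X := X)
      (Y := fun j => y (X j)) (δ := δ) (fun e => by rw [← congrFun hξ' e]; rfl)
    have ih' := ih (Fin.tail X) (fun e => w₁ e - N.weight e) (Fin.tail δ)
    rw [← hξ'] at ih'
    rw [pathValue, Set.indicator_apply, ← hw₁, ih', ← ite_and, hs]
    refine if_congr ?_ rfl rfl
    rw [Fin.forall_fin_succ]
    refine and_congr Iff.rfl (forall_congr' fun i => ?_)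
    have := hs i (by omega)
    simp only [Fin.val_succ]
    rw [this]
    rfl

end NeuralNet

instance {n T : ℕ} {ι : Type*} [Fintype ι] {σ σ' : NNReal} :
    IsProbabilityMeasure (experiment n T ι σ σ') := by
  unfold experiment
  infer_instance

/-- The sum over hidden sets stands inside the sum over test inputs, since the reward family is
analysed for a fixed test input. -/
theorem lintegral_experiment {n T : ℕ} {ι : Type*} [Fintype ι] {σ σ' : NNReal}
    {f : Outcome n T ι → ENNReal} (hf : Measurable f) :
    ∫⁻ ω, f ω ∂(experiment n T ι σ σ')
      = (2 ^ n)⁻¹ * ∑ x, (2 ^ n)⁻¹ * ∑ s, ∫⁻ ξ, ∫⁻ X, ∫⁻ δ, f (s, x, ξ, X, δ)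
          ∂(Measure.pi fun _ : Fin T => isotropicGaussian ι σ')
          ∂(Measure.pi fun _ : Fin T => uniformOn (Set.univ : Set (Fin n → Bool)))
          ∂(isotropicGaussian ι σ) := by
  rw [experiment, lintegral_prod _ hf.aemeasurable, lintegral_uniformOn_univ]
  have h1 : ∀ s : Finset (Fin n), Measurable fun p => f (s, p) := fun s =>
    hf.comp measurable_prodMk_left
  have h2 : ∀ (s : Finset (Fin n)) (x : Fin n → Bool), Measurable fun p => f (s, x, p) :=
    fun s x => (h1 s).comp measurable_prodMk_left
  have h3 : ∀ (s : Finset (Fin n)) (x : Fin n → Bool) (ξ : ι → ℝ),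
      Measurable fun p => f (s, x, ξ, p) := fun s x ξ => (h2 s x).comp measurable_prodMk_left
  simp_rw [lintegral_prod _ (h1 _).aemeasurable, lintegral_uniformOn_univ,
    lintegral_prod _ (h2 _ _).aemeasurable, lintegral_prod _ (h3 _ _ _).aemeasurable]
  simp only [Fintype.card_finset, Fintype.card_fin, Fintype.card_pi, Fintype.card_bool,
    Finset.prod_const, Finset.card_univ, Nat.cast_pow, Nat.cast_ofNat]
  simp only [← Finset.mul_sum]
  rw [Finset.sum_comm]

namespace NeuralNet

variable {n : ℕ} {V : Type*} [Fintype V] [DecidableEq V]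

open Classical in
/-- The indicator of a correct prediction of the parity of the bits of `x` in `s`. -/
noncomputable def reward (N : NeuralNet n V) (enc : Bool → ℝ) (D : ℝ → ℝ) (x : Fin n → Bool)
    (s : Finset (Fin n)) (w : N.edges → ℝ) : ENNReal :=
  if D (N.eval w (fun j => enc (x j))) = enc (parity s x) then 1 else 0

theorem reward_le_one (N : NeuralNet n V) (enc : Bool → ℝ) (D : ℝ → ℝ) (x : Fin n → Bool)
    (s : Finset (Fin n)) (w : N.edges → ℝ) : N.reward enc D x s w ≤ 1 := by
  unfold reward
  split_ifs <;> simp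

theorem measurable_reward (N : NeuralNet n V) (hact : ContDiff ℝ 3 N.act) (enc : Bool → ℝ)
    {D : ℝ → ℝ} (hD : Measurable D) (x : Fin n → Bool) (s : Finset (Fin n)) :
    Measurable (N.reward enc D x s) := by
  have h : Measurable fun w => D (N.eval w (fun j => enc (x j))) :=
    hD.comp (N.contDiff_value hact _ N.out).continuous.measurable
  exact Measurable.ite (h (measurableSet_singleton _)) measurable_const measurable_const

/-- A prediction which does not depend on the hidden set is correct for half of the sets. -/
theorem average_reward_le (N : NeuralNet n V) {enc : Bool → ℝ} (henc : Function.Injective enc)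
    (D : ℝ → ℝ) (x : Fin n → Bool) (w : N.edges → ℝ) :
    (2 ^ n)⁻¹ * ∑ s, N.reward enc D x s w ≤ 2⁻¹ + if x = (fun _ => false) then 1 else 0 := by
  classical
  by_cases hx : x = fun _ => false
  · rw [if_pos hx]
    calc (2 ^ n)⁻¹ * ∑ s, N.reward enc D x s w
        ≤ (2 ^ n : ENNReal)⁻¹ * ∑ _s : Finset (Fin n), 1 := by
          gcongr
          exact N.reward_le_one _ _ _ _ _
      _ = 1 := by
          simp
          exact ENNReal.inv_mul_cancel (by simp) (by simp)
      _ ≤ _ := le_add_self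
  · rw [if_neg hx, add_zero]
    have hx' : ∃ i, x i = true := by
      by_contra! h
      exact hx (funext fun i => by simpa using h i)
    -- As `enc` is injective, the prediction encodes at most one bit; if it encodes none, any b
    -- serves.
    obtain ⟨b, hb⟩ : ∃ b, ∀ c, D (N.eval w (fun j => enc (x j))) = enc c → c = b := by
      by_cases h : D (N.eval w (fun j => enc (x j))) = enc true
      · exact ⟨true, fun c hc => henc (hc.symm.trans h)⟩
      · exact ⟨false, fun c hc => by
          cases c
          · rfl
          · exact absurd hc h⟩
    have hle : ∀ s, N.reward enc D x s w ≤ ENNReal.ofReal (if parity s x = b then 1 else 0) := by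
      intro s
      unfold reward
      split_ifs with h1 h2
      · simp
      · exact absurd (hb _ h1) h2
      · simp
      · simp
    calc (2 ^ n)⁻¹ * ∑ s, N.reward enc D x s w
        ≤ (2 ^ n : ENNReal)⁻¹ * ∑ s, ENNReal.ofReal (if parity s x = b then 1 else 0) := by
          gcongr with s
          exact hle s
      _ = (2 ^ n : ENNReal)⁻¹ * (2 ^ n * 2⁻¹) := by
          rw [← ENNReal.ofReal_sum_of_nonneg fun s _ => by split_ifs <;> norm_num,
            sum_parity_eq hx', ENNReal.ofReal_div_of_pos (by norm_num), div_eq_mul_inv,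
            ENNReal.ofReal_pow (by norm_num)]
          simp
      _ = 2⁻¹ := by
          rw [← mul_assoc, ENNReal.inv_mul_cancel (by simp) (by simp), one_mul]

/-- On this event the killed process is never stopped and earns reward 1, so the probability is at
most the expected killed reward. Only the reward has to be measurable, not the events. -/
theorem correctEvent_diff_le (N : NeuralNet n V) (hact : ContDiff ℝ 3 N.act) {L : ℝ → ℝ}
    (hL : ContDiff ℝ 3 L) {enc : Bool → ℝ} (henc : Function.Injective enc) {D : ℝ → ℝ}
    (hD : Measurable D) {B γ τ : ℝ} (T : ℕ) {σ σ' C₁ R : NNReal}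
    (hc : StepConstants N.edges σ σ' B γ (B * gaussianRadius N.edges σ) C₁ (1 + R))
    (hτ : 2 * gaussianRadius N.edges σ ≤ τ) :
    experiment n T N.edges σ σ' (N.correctEvent L enc γ D T \ N.largeDerivEvent L enc γ B τ T)
      ≤ 2⁻¹ + (2 ^ n)⁻¹ + T * (R + isotropicGaussian N.edges σ (gaussianBall N.edges σ)ᶜ
        + ENNReal.ofReal (C₁ / (2 * √(2 ^ n)))) := by
  classical
  set G : (Fin n → Bool) → Bool → (N.edges → ℝ) → N.edges → ℝ :=
    fun x y w e => partialDeriv e (N.loss L enc x y) w with hGdef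
  set good : (Fin n → Bool) → Bool → Set (N.edges → ℝ) :=
    fun x y => tameSet B τ (N.loss L enc x y) with hgooddef
  have hl : ∀ x y, ContDiff ℝ 3 (N.loss L enc x y) := fun x y => N.contDiff_loss hact hL enc x y
  have hG : ∀ x y, Measurable (G x y) := fun x y => measurable_pi_lambda _ fun e =>
    (contDiff_partialDeriv (k := 2) (l := 3) rfl (hl x y) e).continuous.measurable
  have hgood : ∀ x y, MeasurableSet (good x y) := fun x y => measurableSet_tameSet B τ (hl x y)
  set f : Outcome n T N.edges → ENNReal := fun ω =>
    pathValue γ (fun x => G x (parity ω.1 x)) (fun x => good x (parity ω.1 x))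
      (N.reward enc D ω.2.1 ω.1) T ω.2.2.2.1 (fun e => N.weight e + ω.2.2.1 e) ω.2.2.2.2 with hf
  have hfm : Measurable f := by
    refine measurable_from_prod_countable_right fun s => ?_
    refine measurable_from_prod_countable_right fun x => ?_
    have h1 : Measurable fun p : (Fin T → Fin n → Bool) × (N.edges → ℝ) × (Fin T → N.edges → ℝ) =>
        f (s, x, p.2.1, p.1, p.2.2) := by
      refine measurable_from_prod_countable_right fun X => ?_
      refine (measurable_pathValue (fun x => hG x (parity s x)) (fun x => hgood x (parity s x))
        (N.measurable_reward hact enc hD x s) T X).comp (Measurable.prodMk ?_ measurable_snd)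
      fun_prop
    exact h1.comp (f := fun p : (N.edges → ℝ) × (Fin T → Fin n → Bool) × (Fin T → N.edges → ℝ) =>
      (p.2.1, p.1, p.2.2)) (by fun_prop)
  have hle : ∀ ω ∈ N.correctEvent L enc γ D T \ N.largeDerivEvent L enc γ B τ T, 1 ≤ f ω := by
    rintro ⟨s, x, ξ, X, δ⟩ ⟨hcorrect, hlarge⟩
    have hpath := N.pathValue_eq L enc γ (parity s) (fun x => good x (parity s x))
      (N.reward enc D x s) X ξ δ
    have hall : ∀ i : Fin T, N.noisySGD L enc γ ξ X (fun j => parity s (X j)) δ i i.isLt.le ∈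
        good (X i) (parity s (X i)) := fun i w hw hbad => hlarge ⟨i, w, hw, hbad⟩
    rw [if_pos hall] at hpath
    change 1 ≤ pathValue γ _ _ _ T X _ δ
    rw [hpath, reward]
    exact (if_pos (show D _ = enc (parity s x) from hcorrect)).ge
  refine (meas_le_lintegral₀ hfm.aemeasurable hle).trans ?_
  rw [lintegral_experiment hfm]
  set η := (R : ENNReal) + isotropicGaussian N.edges σ (gaussianBall N.edges σ)ᶜ
        + ENNReal.ofReal (C₁ / (2 * √(2 ^ n)))
  calc _ ≤ (2 ^ n)⁻¹ * ∑ x : Fin n → Bool,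
        ((2⁻¹ + if x = (fun _ => false) then 1 else 0) + T * η) := by
        gcongr with x
        have h := hc.average_iterate_stepValue_le hG hgood
          (fun μ x y => exists_controlledField (hl x y) hτ)
          (N.measurable_reward hact enc hD x) (N.reward_le_one enc D x)
          (N.average_reward_le henc D x) T N.weight
        refine le_trans (le_of_eq ?_) h
        congr 1
        refine Finset.sum_congr rfl fun s _ => lintegral_congr fun ξ => ?_
        exact lintegral_pathValue hG hgood (N.measurable_reward hact enc hD x) s T (N.weight + ξ)
    _ = 2⁻¹ + (2 ^ n)⁻¹ + T * η := by
        rw [Finset.sum_add_distrib, Finset.sum_add_distrib]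
        simp only [Finset.sum_const, Finset.card_univ, Fintype.card_pi, Fintype.card_bool,
          Finset.prod_const, Fintype.card_fin, nsmul_eq_mul, Nat.cast_pow, Nat.cast_ofNat,
          Finset.sum_ite_eq', Finset.mem_univ, if_true]
        have h2 : (2 ^ n : ENNReal)⁻¹ * 2 ^ n = 1 := ENNReal.inv_mul_cancel (by simp) (by simp)
        rw [mul_add, mul_add, ← mul_assoc, ← mul_assoc _ _ (T * η), h2, one_mul, one_mul, mul_one]

end NeuralNet

end ParityNet

theorem theorem3 {n : ℕ} (hn : 0 < n) {V : Type*} [Fintype V] [DecidableEq V]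
    (N : ParityNet.NeuralNet n V) (hact : ContDiff ℝ 3 N.act)
    (L : ℝ → ℝ) (hL : ContDiff ℝ 3 L)
    (enc : Bool → ℝ) (henc : Function.Injective enc)
    (D : ℝ → ℝ) (hD : Measurable D)
    (m : ℕ) (hm : m = N.edges.card)
    (B γ : ℝ) (hB : 0 < B) (hγ : 0 < γ) (hγ' : γ ≤ Real.pi * n / (80 * m ^ 2 * B))
    (T : ℕ) (hT : 0 < T)
    (σ σ' : NNReal)
    (hσ : (σ : ℝ) = (40 * m * γ * B / n) ^ 2 / (2 * Real.pi))
    (hσ' : (σ' : ℝ) = (2 * m * B * γ - m ^ 2 * B ^ 2 * γ ^ 2) * σ)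
    (p : ℝ)
    (hp : p = (ParityNet.experiment n T N.edges σ σ').real
      (N.largeDerivEvent L enc γ B (160 * m ^ 2 * γ * B / (Real.pi * n)) T)) :
    (ParityNet.experiment n T N.edges σ σ').real (N.correctEvent L enc γ D T) ≤
      1 / 2 + 2 * p + T * (360 * m ^ 4 * B ^ 2 * γ ^ 2 / (Real.pi * n)
        + 7 * (Real.exp 1 / 4) ^ ((n : ℝ) / 4)) := by
  have hcard : Fintype.card N.edges = m := by rw [hm, Fintype.card_coe]
  have hnm : n + 1 ≤ m := hm ▸ N.succ_le_card_edges hn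
  have hπ := Real.pi_pos
  have hT1 : (1 : ℝ) ≤ T := by exact_mod_cast hT
  have hp0 : 0 ≤ p := hp ▸ measureReal_nonneg
  set r : ℝ := (Real.exp 1 / 4) ^ ((n : ℝ) / 4) with hr
  have hr0 : 0 ≤ r := by positivity
  obtain ⟨R, hR⟩ : ∃ R : NNReal, (R : ℝ) = 360 * m ^ 4 * B ^ 2 * γ ^ 2 / (Real.pi * n) :=
    ⟨⟨_, by positivity⟩, rfl⟩
  rw [← hR]
  -- If R ≥ 1/2 the claimed bound is at least 1, because T ≥ 1.
  rcases le_total (1 / 2 : ℝ) R with hR2 | hR2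
  · have : (1 : ℝ) * (1 / 2) ≤ T * (R + 7 * r) :=
      mul_le_mul hT1 (by linarith) (by norm_num) (by linarith)
    linarith [measureReal_le_one (μ := ParityNet.experiment n T N.edges σ σ')
      (s := N.correctEvent L enc γ D T)]
  obtain ⟨C₁, hC₁⟩ : ∃ C₁ : NNReal, (C₁ : ℝ) = Real.exp (n / 4) :=
    ⟨⟨_, (Real.exp_pos _).le⟩, rfl⟩
  obtain ⟨hc, hτ⟩ := ParityNet.stepConstants_of_rate_le (ι := N.edges) hn (by omega) hB hγ
    (by rwa [hcard]) (by rwa [hcard]) (by rwa [hcard]) (by rwa [hcard]) hR2 hC₁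
  rw [hcard] at hτ
  set P := ParityNet.experiment n T N.edges σ σ'
  set E := N.largeDerivEvent L enc γ B (160 * m ^ 2 * γ * B / (Real.pi * n)) T
  have htail : ParityNet.isotropicGaussian N.edges σ (ParityNet.gaussianBall N.edges σ)ᶜ
      ≤ ENNReal.ofReal r := by
    refine (ParityNet.isotropicGaussian_tail_le hc.var_ne_zero).trans (ENNReal.ofReal_le_ofReal ?_)
    rw [hcard]
    exact ParityNet.tail_le_rpow (by omega)
  have hmain : P (N.correctEvent L enc γ D T \ E)
      ≤ ENNReal.ofReal (1 / 2 + r + T * (R + r + r / 2)) := by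
    refine (N.correctEvent_diff_le hact hL henc hD T hc hτ).trans ?_
    rw [ENNReal.ofReal_add (by positivity) (by positivity),
      ENNReal.ofReal_add (by positivity) (by positivity), ENNReal.ofReal_mul (by positivity),
      ENNReal.ofReal_add (by positivity) (by positivity),
      ENNReal.ofReal_add (by positivity) (by positivity), ENNReal.ofReal_natCast,
      ENNReal.ofReal_coe_nnreal, hC₁, ParityNet.exp_div_sqrt_two_pow]
    gcongr
    · simp
    · refine le_trans (le_of_eq ?_) (ENNReal.ofReal_le_ofReal (ParityNet.two_rpow_neg_le_rpow n))
      rw [ENNReal.ofReal_inv_of_pos (by positivity), ENNReal.ofReal_pow (by norm_num)]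
      simp
  have hdiff : P.real (N.correctEvent L enc γ D T \ E) ≤ 1 / 2 + r + T * (R + r + r / 2) :=
    ENNReal.toReal_le_of_le_ofReal (by positivity) hmain
  have hsplit : P.real (N.correctEvent L enc γ D T)
      ≤ p + P.real (N.correctEvent L enc γ D T \ E) := by
    rw [hp]
    refine (measureReal_mono ?_).trans (measureReal_union_le _ _)
    rw [Set.union_sdiff_self]
    exact Set.subset_union_right
  -- Since T ≥ 1, the term r from the zero test input is at most T r, so 5/2 would do in place of 7;
  -- likewise p would do in place of 2p.
  nlinarith
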